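/- **Mal'cev's theorem for local Lie groupoids.** *A strongly connected local Lie groupoid is globalizable if and only if it is globally associative.* Here all manifolds are smooth, finite-dimensional and second countable. Manifolds of arrows may be non-Hausdorff, but unit manifolds and the fibers of source and target maps are Hausdorff. A *local Lie groupoid* $G$ over a manifold $M$ is a manifold $G$ with submersions $s,t:G\to M$ (source and target), a smooth unit map $u:M\to G$ with $s\circ u=t\circ u=\mathrm{id}_M$, a smooth submersion $m:\mathcal U\to G$, $(g,h)\mapsto gh$, defined on an open subset $\mathcal U$ of $G\,{}_s\!\times_t G=\{(g,h): s(g)=t(h)\}$ containing $(g,u(s(g)))$ and $(u(t(g)),g)$ for all $g\in G$, and a smooth map $i:\mathcal V\to\mathcal V$ on an open neighborhood $\mathcal V$ of $u(M)$ in $G$ with $(\mathcal V\times\mathcal V)\cap (G\,{}_s\!\times_t G)\subset\mathcal U$, such that: $s(gh)=s(h)$ and $t(gh)=t(g)$ for $(g,h)\in\mathcal U$; $(gh)k=g(hk)$ (both sides being defined) on an open set of composable triples containing all $(u(t(g)),u(t(g)),g)$, $(u(t(g)),g,u(s(g)))$, $(g,u(s(g)),u(s(g)))$; $g\,u(s(g))=g=u(t(g))\,g$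 for all $g\in G$; and $s(i(g))=t(g)$, $t(i(g))=s(g)$, $i(g)g=u(s(g))$, $g\,i(g)=u(t(g))$ for $g\in\mathcal V$. It is *bi-regular* if for all $(h,g)\in\mathcal U$ right multiplication by $g$ induces an isomorphism $\ker ds_h\to\ker ds_{hg}$ and left multiplication by $h$ induces an isomorphism $\ker dt_g\to\ker dt_{hg}$. It is *strongly connected* if $M$, $\mathcal U$, $\mathcal V$, all source fibers, all target fibers, and all sets $\{(g,h)\in\mathcal U: s(g)=t(h)=x\}$, $x\in M$, are connected and $G$ is bi-regular. It is *globally associative* if for every $n\ge 3$ and every $(x_1,\dots,x_n)\in G^n$ with $s(x_i)=t(x_{i+1})$ for $1\le i<n$, all defined $n$-fold products of $(x_1,\dots,x_n)$, for all ways of putting in brackets, are equal. It is *globalizable* if it is, up to isomorphism, a restriction of an open neighborhood $\Omega$ of the units in a Lie groupoid $\mathcal G$ over $M$: there is a diffeomorphism $\Phi:G\to\Omega$ that is compatible with source, target and unit maps and satisfies $\Phi(gh)=\Phi(g)\Phi(h)$ for $(g,h)\in\mathcal U$ and $\Phi(i(g))=\Phi(g)^{-1}$ for $g\in\mathcal V$.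 -/

import Mathlib

open scoped Manifold ContDiff Topology

universe uE uF uG uM

/-!
Manifolds of arrows are modelled on a finite-dimensional real vector space `E`, manifolds of units
on a finite-dimensional real vector space `F`.  Manifolds of arrows are second countable but need
not be Hausdorff; unit manifolds and the fibers of the source and target maps are Hausdorff.
Arrows compose from right to left: `g h` can only be defined if `s g = t h`.
-/

/-- The set of composable pairs (the fiber product of `G` with itself over `s` and `t`). -/
def composablePairs {G : Type uG} {M : Type uM} (s t : G → M) : Set (G × G) :=
  {p | s p.1 = t p.2}

/-- The set of composable triples. -/
def composableTriples {G : Type uG} {M : Type uM} (s t : G → M) : Set (G × G × G) :=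
  {p | s p.1 = t p.2.1 ∧ s p.2.1 = t p.2.2}

/-- A local Lie groupoid with manifold of arrows `G` and manifold of units `M`.

The multiplication is only meaningful on `mulDomain`, and the inversion only on `invDomain`; the
values of the functions `mul` and `inv` elsewhere carry no information.  Since the fiber product of
`G` with itself is an embedded submanifold of `G × G`, and `mulDomain` is an open part of it,
smoothness of the multiplication is `ContMDiffOn` on `mulDomain` (existence of smooth local
extensions).  The tangent space of `mulDomain` at `p` consists of the tangent vectors `ζ` of `G × G`
at `p` with `d(s ∘ pr₁) ζ = d(t ∘ pr₂) ζ`, and on these vectors `mfderivWithin` is the differential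
of the multiplication. -/
structure LocalLieGroupoid
    (E : Type uE) [NormedAddCommGroup E] [NormedSpace ℝ E]
    (F : Type uF) [NormedAddCommGroup F] [NormedSpace ℝ F]
    (G : Type uG) [TopologicalSpace G] [ChartedSpace E G]
    (M : Type uM) [TopologicalSpace M] [ChartedSpace F M] where
  /-- the source map -/
  s : G → M
  /-- the target map -/
  t : G → M
  /-- the unit map -/
  u : M → G
  /-- the domain of the multiplication -/
  mulDomain : Set (G × G)
  /-- the multiplication -/
  mul : G → G → G
  /-- the domain of the inversion -/
  invDomain : Set G
  /-- the inversion -/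
  inv : G → G
  isSubmersion_s : Manifold.IsSubmersion 𝓘(ℝ, E) 𝓘(ℝ, F) ∞ s
  isSubmersion_t : Manifold.IsSubmersion 𝓘(ℝ, E) 𝓘(ℝ, F) ∞ t
  t2_source_fiber : ∀ x, T2Space (s ⁻¹' {x})
  t2_target_fiber : ∀ x, T2Space (t ⁻¹' {x})
  contMDiff_u : ContMDiff 𝓘(ℝ, F) 𝓘(ℝ, E) ∞ u
  s_u : ∀ x, s (u x) = x
  t_u : ∀ x, t (u x) = x
  /-- `mulDomain` is an open subset of the fiber product -/
  mulDomain_open : ∃ O : Set (G × G), IsOpen O ∧ mulDomain = O ∩ composablePairs s t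
  mul_unit_mem : ∀ g, (g, u (s g)) ∈ mulDomain
  unit_mul_mem : ∀ g, (u (t g), g) ∈ mulDomain
  contMDiffOn_mul :
    ContMDiffOn (𝓘(ℝ, E).prod 𝓘(ℝ, E)) 𝓘(ℝ, E) ∞ (fun p : G × G => mul p.1 p.2) mulDomain
  /-- the multiplication is a submersion: its differential at each point of `mulDomain` maps the
  tangent space of the fiber product onto the tangent space of `G` -/
  submersion_mul : ∀ p ∈ mulDomain, ∀ z : TangentSpace 𝓘(ℝ, E) (mul p.1 p.2),
    ∃ ζ : TangentSpace (𝓘(ℝ, E).prod 𝓘(ℝ, E)) p,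
      (mfderiv (𝓘(ℝ, E).prod 𝓘(ℝ, E)) 𝓘(ℝ, F) (fun q : G × G => s q.1) p ζ : F) =
        (mfderiv (𝓘(ℝ, E).prod 𝓘(ℝ, E)) 𝓘(ℝ, F) (fun q : G × G => t q.2) p ζ : F) ∧
      mfderivWithin (𝓘(ℝ, E).prod 𝓘(ℝ, E)) 𝓘(ℝ, E) (fun q : G × G => mul q.1 q.2) mulDomain p ζ = z
  invDomain_open : IsOpen invDomain
  unit_mem_invDomain : ∀ x, u x ∈ invDomain
  inv_mem : ∀ g ∈ invDomain, inv g ∈ invDomain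
  contMDiffOn_inv : ContMDiffOn 𝓘(ℝ, E) 𝓘(ℝ, E) ∞ inv invDomain
  invDomain_mul : ∀ g ∈ invDomain, ∀ h ∈ invDomain, s g = t h → (g, h) ∈ mulDomain
  s_mul : ∀ g h, (g, h) ∈ mulDomain → s (mul g h) = s h
  t_mul : ∀ g h, (g, h) ∈ mulDomain → t (mul g h) = t g
  /-- associativity (both sides being defined) holds on a relatively open set of composable triples
  that contains all triples in which at least two of the entries are units -/
  assoc_near_units : ∃ W : Set (G × G × G),
    (∃ O : Set (G × G × G), IsOpen O ∧ W = O ∩ composableTriples s t) ∧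
    (∀ g, (u (t g), u (t g), g) ∈ W) ∧
    (∀ g, (u (t g), g, u (s g)) ∈ W) ∧
    (∀ g, (g, u (s g), u (s g)) ∈ W) ∧
    ∀ g h k, (g, h, k) ∈ W →
      (g, h) ∈ mulDomain ∧ (mul g h, k) ∈ mulDomain ∧
      (h, k) ∈ mulDomain ∧ (g, mul h k) ∈ mulDomain ∧
      mul (mul g h) k = mul g (mul h k)
  mul_unit : ∀ g, mul g (u (s g)) = g
  unit_mul : ∀ g, mul (u (t g)) g = g
  s_inv : ∀ g ∈ invDomain, s (inv g) = t g
  t_inv : ∀ g ∈ invDomain, t (inv g) = s g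
  inv_mul : ∀ g ∈ invDomain, mul (inv g) g = u (s g)
  mul_inv : ∀ g ∈ invDomain, mul g (inv g) = u (t g)

/-- A (global) Lie groupoid with manifold of arrows `H` and manifold of units `M`.  The value of
`mul g h` only matters for composable pairs `(g, h)`. -/
structure LieGroupoid
    (E : Type uE) [NormedAddCommGroup E] [NormedSpace ℝ E]
    (F : Type uF) [NormedAddCommGroup F] [NormedSpace ℝ F]
    (H : Type uG) [TopologicalSpace H] [ChartedSpace E H]
    (M : Type uM) [TopologicalSpace M] [ChartedSpace F M] where
  /-- the source map -/
  s : H → M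
  /-- the target map -/
  t : H → M
  /-- the unit map -/
  u : M → H
  /-- the multiplication -/
  mul : H → H → H
  /-- the inversion -/
  inv : H → H
  isSubmersion_s : Manifold.IsSubmersion 𝓘(ℝ, E) 𝓘(ℝ, F) ∞ s
  isSubmersion_t : Manifold.IsSubmersion 𝓘(ℝ, E) 𝓘(ℝ, F) ∞ t
  t2_source_fiber : ∀ x, T2Space (s ⁻¹' {x})
  t2_target_fiber : ∀ x, T2Space (t ⁻¹' {x})
  contMDiff_u : ContMDiff 𝓘(ℝ, F) 𝓘(ℝ, E) ∞ u
  contMDiffOn_mul : ContMDiffOn (𝓘(ℝ, E).prod 𝓘(ℝ, E)) 𝓘(ℝ, E) ∞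
    (fun p : H × H => mul p.1 p.2) (composablePairs s t)
  contMDiff_inv : ContMDiff 𝓘(ℝ, E) 𝓘(ℝ, E) ∞ inv
  s_u : ∀ x, s (u x) = x
  t_u : ∀ x, t (u x) = x
  s_mul : ∀ g h, s g = t h → s (mul g h) = s h
  t_mul : ∀ g h, s g = t h → t (mul g h) = t g
  mul_assoc : ∀ g h k, s g = t h → s h = t k → mul (mul g h) k = mul g (mul h k)
  mul_unit : ∀ g, mul g (u (s g)) = g
  unit_mul : ∀ g, mul (u (t g)) g = g
  s_inv : ∀ g, s (inv g) = t g
  t_inv : ∀ g, t (inv g) = s g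
  inv_mul : ∀ g, mul (inv g) g = u (s g)
  mul_inv : ∀ g, mul g (inv g) = u (t g)

namespace LocalLieGroupoid

variable {E : Type uE} [NormedAddCommGroup E] [NormedSpace ℝ E]
  {F : Type uF} [NormedAddCommGroup F] [NormedSpace ℝ F]
  {G : Type uG} [TopologicalSpace G] [ChartedSpace E G]
  {M : Type uM} [TopologicalSpace M] [ChartedSpace F M]

/-- `L.EvaluatesTo w g`: for some way of putting in brackets, the product of the word `w` is
defined, with value `g`. -/
inductive EvaluatesTo (L : LocalLieGroupoid E F G M) : List G → G → Prop
  | single (g : G) : EvaluatesTo L [g] g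
  | mul {w₁ w₂ : List G} {g h : G} : EvaluatesTo L w₁ g → EvaluatesTo L w₂ h →
      (g, h) ∈ L.mulDomain → EvaluatesTo L (w₁ ++ w₂) (L.mul g h)

/-- A word is well-formed if the source of each letter is the target of the next one. -/
def WellFormed (L : LocalLieGroupoid E F G M) (w : List G) : Prop :=
  w.IsChain (fun g h => L.s g = L.t h)

/-- Associativity to order `n`: for `3 ≤ m ≤ n`, all defined products of a well-formed `m`-tuple
are equal. -/
def AssociativeToOrder (L : LocalLieGroupoid E F G M) (n : ℕ) : Prop :=
  ∀ w : List G, 3 ≤ w.length → w.length ≤ n → L.WellFormed w →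
    ∀ g h : G, L.EvaluatesTo w g → L.EvaluatesTo w h → g = h

/-- Global associativity: associativity to every order `n ≥ 3`. -/
def GloballyAssociative (L : LocalLieGroupoid E F G M) : Prop :=
  ∀ n : ℕ, 3 ≤ n → L.AssociativeToOrder n

/-- The tangent space of the source fiber at `h`, as the kernel of `ds`. -/
def sourceTangent (L : LocalLieGroupoid E F G M) (h : G) : Set (TangentSpace 𝓘(ℝ, E) h) :=
  {v | mfderiv 𝓘(ℝ, E) 𝓘(ℝ, F) L.s h v = 0}

/-- The tangent space of the target fiber at `h`, as the kernel of `dt`. -/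
def targetTangent (L : LocalLieGroupoid E F G M) (h : G) : Set (TangentSpace 𝓘(ℝ, E) h) :=
  {v | mfderiv 𝓘(ℝ, E) 𝓘(ℝ, F) L.t h v = 0}

/-- Right-regularity at `g`: right multiplication by `g`, which is defined on the open part
`{h | (h, g) ∈ mulDomain}` of the source fiber over `t g`, induces an isomorphism from the tangent
space of this source fiber at `h` to the tangent space of the source fiber through `h g` at
`h g`. -/
def RightRegularAt (L : LocalLieGroupoid E F G M) (g : G) : Prop :=
  ∀ h : G, (h, g) ∈ L.mulDomain →
    Set.BijOn
      (mfderivWithin 𝓘(ℝ, E) 𝓘(ℝ, E) (fun k => L.mul k g) {k | (k, g) ∈ L.mulDomain} h)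
      (L.sourceTangent h) (L.sourceTangent (L.mul h g))

/-- Left-regularity at `g`. -/
def LeftRegularAt (L : LocalLieGroupoid E F G M) (g : G) : Prop :=
  ∀ h : G, (g, h) ∈ L.mulDomain →
    Set.BijOn
      (mfderivWithin 𝓘(ℝ, E) 𝓘(ℝ, E) (fun k => L.mul g k) {k | (g, k) ∈ L.mulDomain} h)
      (L.targetTangent h) (L.targetTangent (L.mul g h))

/-- A local Lie groupoid is bi-regular if it is left-regular and right-regular at every arrow. -/
def BiRegular (L : LocalLieGroupoid E F G M) : Prop :=
  ∀ g : G, L.LeftRegularAt g ∧ L.RightRegularAt g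

/-- Strong connectedness of a local Lie groupoid. -/
structure StronglyConnected (L : LocalLieGroupoid E F G M) : Prop where
  connected_units : ConnectedSpace M
  connected_mulDomain : IsConnected L.mulDomain
  connected_invDomain : IsConnected L.invDomain
  connected_mulDomain_over : ∀ x : M,
    IsConnected {p : G × G | p ∈ L.mulDomain ∧ L.s p.1 = x ∧ L.t p.2 = x}
  source_connected : ∀ x : M, IsConnected (L.s ⁻¹' {x})
  target_connected : ∀ x : M, IsConnected (L.t ⁻¹' {x})
  biRegular : L.BiRegular

/-- Up to the diffeomorphism `Φ` from `G` onto `Ω`, the local Lie groupoid `L` is a restriction of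
the open neighborhood `Ω` of the units in the Lie groupoid `𝒢`.  Here `Ω` is regarded as a local
Lie groupoid: the product of two composable arrows of `Ω` is defined if it lies in `Ω`, and the
inverse of an arrow of `Ω` is defined if it lies in `Ω`.  A restriction has the same arrows, units,
source, target and unit maps; its multiplication and inversion are restrictions to smaller
domains. -/
structure IsRestrictionOf (L : LocalLieGroupoid E F G M)
    {H : Type uG} [TopologicalSpace H] [ChartedSpace E H] (𝒢 : LieGroupoid E F H M)
    (Ω : TopologicalSpace.Opens H) (Φ : Diffeomorph 𝓘(ℝ, E) 𝓘(ℝ, E) G Ω ∞) : Prop where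
  unit_mem : ∀ x, 𝒢.u x ∈ Ω
  map_s : ∀ g, 𝒢.s (Φ g) = L.s g
  map_t : ∀ g, 𝒢.t (Φ g) = L.t g
  map_u : ∀ x, (Φ (L.u x) : H) = 𝒢.u x
  mul_mem : ∀ g h, (g, h) ∈ L.mulDomain → 𝒢.mul (Φ g) (Φ h) ∈ Ω
  map_mul : ∀ g h, (g, h) ∈ L.mulDomain → (Φ (L.mul g h) : H) = 𝒢.mul (Φ g) (Φ h)
  inv_mem : ∀ g ∈ L.invDomain, 𝒢.inv (Φ g) ∈ Ω
  map_inv : ∀ g ∈ L.invDomain, (Φ (L.inv g) : H) = 𝒢.inv (Φ g)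

/-- A local Lie groupoid is globalizable if it is a restriction of an open neighborhood of the
units in a Lie groupoid (over the same unit manifold). -/
def Globalizable (L : LocalLieGroupoid E F G M) : Prop :=
  ∃ (H : Type uG) (_ : TopologicalSpace H) (_ : ChartedSpace E H)
    (_ : IsManifold 𝓘(ℝ, E) ∞ H) (_ : SecondCountableTopology H)
    (𝒢 : LieGroupoid E F H M) (Ω : TopologicalSpace.Opens H)
    (Φ : Diffeomorph 𝓘(ℝ, E) 𝓘(ℝ, E) G Ω ∞), L.IsRestrictionOf 𝒢 Ω Φ

end LocalLieGroupoid

/-! One direction is evaluation in the ambient groupoid: `Φ` sends the value of every bracketing of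
a word to the product of the images of its letters, which does not see brackets, and `Φ` is
injective.

For the converse the global groupoid is the associative completion: nonempty composable words modulo
the congruence `Eqv` generated by `[g, h] ~ [gh]`. The crux is that `G` embeds in it. A chain of
contractions and expansions between two words can be replaced by a common expansion of both,
provided that every word `w` with value `c d` has a common expansion with `[c, d]`
(`HasCommonExpansions.eqv`). If `[g] ~ [h]`, a common expansion evaluates to both `g` and `h`, and
global associativity gives `g = h`. For the required common expansions, write `c` and `d` as words
`C` and `D` with formal inverses `C'` and `D'`. With a unit `e` in the middle, `C e C' w D' e D`
contracts both to `w` and to `[c, d]`. The words are built by small steps (`Link`): a composable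
pair near `(g, h)` over the same unit has the form `(a g, h b)` with `a`, `b` small, and
connectedness of the composable pairs over a unit joins any pair to the pair of units. The small
factors come from smooth division (`PartialMul.exists_division`), a consequence of bi-regularity and
the inverse function theorem.

The smooth structure of the completion is determined by its plots, the maps represented locally by
smooth families of words of fixed length. Smooth division lifts such families along the congruence
(`Eqv.hasLifts`), so the family can start at any chosen word for the value. Near `p` an arrow is
uniquely a local section of the target map times a small arrow of `G`; this gives charts, for which
smooth maps are exactly plots (`smoothNear_iff_plot`). The operations are then smooth because they
act on words. Inverses exist because connected source fibers make every arrow equivalent to a word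
in `invDomain`. -/

namespace LocalLieGroupoid

/-! ### Composable words and the congruence generated by multiplication -/

section Words

variable {E : Type uE} [NormedAddCommGroup E] [NormedSpace ℝ E]
  {F : Type uF} [NormedAddCommGroup F] [NormedSpace ℝ F]
  {G : Type uG} [TopologicalSpace G] [ChartedSpace E G]
  {M : Type uM} [TopologicalSpace M] [ChartedSpace F M]
  {L : LocalLieGroupoid E F G M}

/-- `L.IsPath y w x`: the letters of `w` are composable, with target `y` and source `x`. -/
def IsPath (L : LocalLieGroupoid E F G M) : M → List G → M → Prop
  | y, [], x => y = x
  | y, g :: w, x => L.t g = y ∧ IsPath L (L.s g) w x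

@[simp] theorem isPath_nil {y x : M} : L.IsPath y [] x ↔ y = x := Iff.rfl

@[simp] theorem isPath_cons {y x : M} {g : G} {w : List G} :
    L.IsPath y (g :: w) x ↔ L.t g = y ∧ L.IsPath (L.s g) w x := Iff.rfl

theorem isPath_append {y x : M} {a b : List G} :
    L.IsPath y (a ++ b) x ↔ ∃ z, L.IsPath y a z ∧ L.IsPath z b x := by
  induction a generalizing y with
  | nil => simp
  | cons g a ih => simp [ih, and_assoc]

/-- The empty word is a path from every unit to itself and so has no well-defined ends; this is why
the completion uses nonempty words. -/
theorem IsPath.unique {w : List G} (hw : w ≠ []) {y x y' x' : M} (h : L.IsPath y w x)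
    (h' : L.IsPath y' w x') : y = y' ∧ x = x' := by
  induction w generalizing y y' with
  | nil => exact absurd rfl hw
  | cons g w ih =>
    obtain ⟨rfl, h⟩ := h
    obtain ⟨rfl, h'⟩ := h'
    refine ⟨rfl, ?_⟩
    cases w with
    | nil => exact h.symm.trans h'
    | cons k w => exact (ih (by simp) h h').2

theorem mem_composable {g h : G} (hgh : (g, h) ∈ L.mulDomain) : L.s g = L.t h := by
  obtain ⟨O, -, hO⟩ := L.mulDomain_open
  rw [hO] at hgh
  exact hgh.2

/-- The congruence on words generated by the multiplication. -/
inductive Eqv (L : LocalLieGroupoid E F G M) : List G → List G → Prop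
  | refl (a : List G) : Eqv L a a
  | symm {a b : List G} : Eqv L a b → Eqv L b a
  | trans {a b c : List G} : Eqv L a b → Eqv L b c → Eqv L a c
  | append {a a' b b' : List G} : Eqv L a a' → Eqv L b b' → Eqv L (a ++ b) (a' ++ b')
  | mul {g h : G} : (g, h) ∈ L.mulDomain → Eqv L [g, h] [L.mul g h]

/-- The congruence is defined on all words, composable or not. Since a product keeps the outer ends
of its factors, composability and ends pass to congruent words. -/
theorem Eqv.isPath {a b : List G} (h : L.Eqv a b) {y x : M} : L.IsPath y a x ↔ L.IsPath y b x := by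
  induction h generalizing y x with
  | refl => rfl
  | symm _ ih => exact ih.symm
  | trans _ _ ih ih' => exact ih.trans ih'
  | append _ _ ih ih' => simp [isPath_append, ih, ih']
  | mul h => simp [L.s_mul _ _ h, L.t_mul _ _ h, mem_composable h]

theorem Eqv.ne_nil {a b : List G} (h : L.Eqv a b) : a ≠ [] ↔ b ≠ [] := by
  induction h with
  | refl => rfl
  | symm _ ih => exact ih.symm
  | trans _ _ ih ih' => exact ih.trans ih'
  | append _ _ ih ih' => simp only [ne_eq, List.append_eq_nil_iff, not_and_or] at *; rw [ih, ih']
  | mul h => simp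

theorem EvaluatesTo.eqv {w : List G} {g : G} (h : L.EvaluatesTo w g) : L.Eqv w [g] := by
  induction h with
  | single g => exact .refl _
  | mul _ _ hgh ih ih' => exact (Eqv.append ih ih').trans (.mul hgh)

theorem EvaluatesTo.isPath {w : List G} {g : G} (h : L.EvaluatesTo w g) :
    L.IsPath (L.t g) w (L.s g) := by
  rw [h.eqv.isPath]; simp

theorem EvaluatesTo.ne_nil {w : List G} {g : G} (h : L.EvaluatesTo w g) : w ≠ [] := by
  rw [h.eqv.ne_nil]; simp

theorem IsPath.wellFormed {w : List G} {y x : M} (h : L.IsPath y w x) : L.WellFormed w := by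
  induction w generalizing y with
  | nil => exact List.IsChain.nil
  | cons g w ih =>
    cases w with
    | nil => exact List.IsChain.singleton g
    | cons k w => exact List.IsChain.cons_cons h.2.1.symm (ih h.2)

theorem EvaluatesTo.of_singleton {g h : G} (H : L.EvaluatesTo [g] h) : h = g := by
  generalize hw : [g] = w at H
  cases H with
  | single => exact (List.singleton_inj.1 hw).symm
  | mul h₁ h₂ _ =>
    have := congrArg List.length hw
    have := List.length_pos_iff.2 h₁.ne_nil
    have := List.length_pos_iff.2 h₂.ne_nil
    simp at *
    omega

theorem EvaluatesTo.of_pair {a b h : G} (H : L.EvaluatesTo [a, b] h) : h = L.mul a b := by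
  generalize hw : [a, b] = w at H
  cases H with
  | single => simp at hw
  | @mul w₁ w₂ _ _ h₁ h₂ _ =>
    have hl := congrArg List.length hw
    have := List.length_pos_iff.2 h₁.ne_nil
    have := List.length_pos_iff.2 h₂.ne_nil
    simp only [List.length_cons, List.length_nil, List.length_append] at hl
    obtain ⟨p, rfl⟩ := List.length_eq_one_iff.1 (show w₁.length = 1 by omega)
    obtain ⟨q, rfl⟩ := List.length_eq_one_iff.1 (show w₂.length = 1 by omega)
    simp only [List.singleton_append, List.cons.injEq, and_true] at hw
    rw [h₁.of_singleton, h₂.of_singleton, hw.1, hw.2]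

/-- In a globally associative local Lie groupoid all values of a word agree. -/
theorem GloballyAssociative.unique (hL : L.GloballyAssociative) {w : List G} {g h : G}
    (hg : L.EvaluatesTo w g) (hh : L.EvaluatesTo w h) : g = h := by
  -- Global associativity concerns words of length at least 3; shorter nonempty words have only one
  -- bracketing.
  match w, hg, hh with
  | [], hg, _ => exact absurd rfl hg.ne_nil
  | [a], hg, hh => rw [hg.of_singleton, hh.of_singleton]
  | [a, b], hg, hh => rw [hg.of_pair, hh.of_pair]
  | a :: b :: c :: w, hg, hh =>
    exact hL _ (by simp) _ (by simp) le_rfl hg.isPath.wellFormed _ _ hg hh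

/-! ### Contractions and common expansions -/

/-- `L.Red w w'`: the word `w` is a concatenation of words that evaluate to the letters of `w'`. -/
inductive Red (L : LocalLieGroupoid E F G M) : List G → List G → Prop
  | nil : Red L [] []
  | cons {v w w' : List G} {g : G} : L.EvaluatesTo v g → Red L w w' → Red L (v ++ w) (g :: w')

theorem Red.refl (w : List G) : L.Red w w := by
  induction w with
  | nil => exact .nil
  | cons g w ih => exact .cons (v := [g]) (.single g) ih

theorem EvaluatesTo.red {w : List G} {g : G} (h : L.EvaluatesTo w g) : L.Red w [g] := by
  simpa using Red.cons h .nil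

theorem Red.append {a a' b b' : List G} (h : L.Red a a') (h' : L.Red b b') :
    L.Red (a ++ b) (a' ++ b') := by
  induction h with
  | nil => exact h'
  | cons hv _ ih => simpa using Red.cons hv ih

theorem Red.split {z a b : List G} (h : L.Red z (a ++ b)) :
    ∃ z₁ z₂, z = z₁ ++ z₂ ∧ L.Red z₁ a ∧ L.Red z₂ b := by
  induction a generalizing z with
  | nil => exact ⟨[], z, rfl, .nil, h⟩
  | cons g a ih =>
    rw [List.cons_append] at h
    cases h with
    | cons hv hw =>
      obtain ⟨z₁, z₂, rfl, h₁, h₂⟩ := ih hw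
      exact ⟨_, z₂, by rw [List.append_assoc], .cons hv h₁, h₂⟩

theorem Red.evaluatesTo {z : List G} {g : G} (h : L.Red z [g]) : L.EvaluatesTo z g := by
  cases h with
  | cons hv hw => cases hw; simpa using hv

theorem EvaluatesTo.subst {w z : List G} {g : G} (h : L.EvaluatesTo w g) (hz : L.Red z w) :
    L.EvaluatesTo z g := by
  induction h generalizing z with
  | single => exact hz.evaluatesTo
  | mul _ _ hgh ih ih' =>
    obtain ⟨z₁, z₂, rfl, h₁, h₂⟩ := hz.split
    exact .mul (ih h₁) (ih' h₂) hgh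

theorem Red.trans {a b c : List G} (h : L.Red a b) (h' : L.Red b c) : L.Red a c := by
  induction h' generalizing a with
  | nil => exact h
  | cons hv _ ih =>
    obtain ⟨z₁, z₂, rfl, h₁, h₂⟩ := h.split
    exact .cons (hv.subst h₁) (ih h₂)

/-- Every expansion of a product `c d` and the word `[c, d]` have a common expansion. -/
def HasCommonExpansions (L : LocalLieGroupoid E F G M) : Prop :=
  ∀ c d, (c, d) ∈ L.mulDomain → ∀ w, L.EvaluatesTo w (L.mul c d) → ∃ z, L.Red z w ∧ L.Red z [c, d]

/-- Induction on a bracketing of `b`. At its outermost product `c d`, the hypothesis expands `a` to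
a word that splits into an expansion of `c` and one of `d`; the two halves are then treated
separately. -/
theorem HasCommonExpansions.evaluatesTo (hL : L.HasCommonExpansions) {a b : List G} {g : G}
    (ha : L.EvaluatesTo a g) (hb : L.EvaluatesTo b g) : ∃ z, L.Red z a ∧ L.Red z b := by
  induction hb generalizing a with
  | single g => exact ⟨a, .refl a, ha.red⟩
  | @mul b₁ b₂ c d h₁ h₂ hcd ih₁ ih₂ =>
    obtain ⟨z, hza, hz⟩ := hL c d hcd a ha
    obtain ⟨z₁, z₂, rfl, hz₁, hz₂⟩ := hz.split (a := [c]) (b := [d])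
    obtain ⟨x₁, hx₁, hy₁⟩ := ih₁ hz₁.evaluatesTo
    obtain ⟨x₂, hx₂, hy₂⟩ := ih₂ hz₂.evaluatesTo
    exact ⟨x₁ ++ x₂, (hx₁.append hx₂).trans hza, hy₁.append hy₂⟩

theorem HasCommonExpansions.red (hL : L.HasCommonExpansions) {a b c : List G}
    (ha : L.Red a c) (hb : L.Red b c) : ∃ z, L.Red z a ∧ L.Red z b := by
  induction hb generalizing a with
  | nil => exact ⟨a, .refl a, ha⟩
  | cons hv _ ih =>
    cases ha with
    | cons hv' hw =>
      obtain ⟨z, h₁, h₂⟩ := hL.evaluatesTo hv' hv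
      obtain ⟨z', h₁', h₂'⟩ := ih hw
      exact ⟨z ++ z', h₁.append h₁', h₂.append h₂'⟩

/-- Transitivity is the case with content: the two common expansions found so far both contract to
the middle word, hence have a common expansion themselves. -/
theorem HasCommonExpansions.eqv (hL : L.HasCommonExpansions) {a b : List G} (h : L.Eqv a b) :
    ∃ z, L.Red z a ∧ L.Red z b := by
  induction h with
  | refl a => exact ⟨a, .refl a, .refl a⟩
  | symm _ ih => obtain ⟨z, h, h'⟩ := ih; exact ⟨z, h', h⟩
  | trans _ _ ih ih' =>
    obtain ⟨z, h₁, h₂⟩ := ih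
    obtain ⟨z', h₁', h₂'⟩ := ih'
    obtain ⟨y, hy, hy'⟩ := hL.red h₂ h₁'
    exact ⟨y, hy.trans h₁, hy'.trans h₂'⟩
  | append _ _ ih ih' =>
    obtain ⟨z, h₁, h₂⟩ := ih
    obtain ⟨z', h₁', h₂'⟩ := ih'
    exact ⟨z ++ z', h₁.append h₁', h₂.append h₂'⟩
  | @mul g h hgh => exact ⟨[g, h], .refl _, (EvaluatesTo.mul (.single g) (.single h) hgh).red⟩

theorem HasCommonExpansions.eq_of_eqv (hL : L.HasCommonExpansions) (hA : L.GloballyAssociative)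
    {g h : G} (H : L.Eqv [g] [h]) : g = h := by
  obtain ⟨z, h₁, h₂⟩ := hL.eqv H
  exact hA.unique h₁.evaluatesTo h₂.evaluatesTo

/-! ### Links between composable pairs -/

/-- A link between two composable pairs: words that expand the first pair to the second one. -/
def Link (L : LocalLieGroupoid E F G M) (p q : G × G) : Prop :=
  ∃ C C' D D' : List G,
    (∀ w, L.EvaluatesTo w q.1 → L.EvaluatesTo (C ++ w) p.1) ∧
    (∀ w, L.EvaluatesTo w q.2 → L.EvaluatesTo (w ++ D) p.2) ∧
    (∀ w, L.EvaluatesTo w (L.mul p.1 p.2) → L.EvaluatesTo (C' ++ w ++ D') (L.mul q.1 q.2)) ∧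
    (∀ w, L.EvaluatesTo w (L.u (L.t q.1)) → L.EvaluatesTo (C ++ w ++ C') (L.u (L.t p.1))) ∧
    (∀ w, L.EvaluatesTo w (L.u (L.s q.2)) → L.EvaluatesTo (D' ++ w ++ D) (L.u (L.s p.2)))

/-- Informally `C` is `p.1 q.1⁻¹`, `D` is `q.2⁻¹ p.2`, and `C'`, `D'` are their inverses. Links nest
under composition, which works because each condition quantifies over all words with the given
value. -/
theorem Link.trans {p q r : G × G} (h : L.Link p q) (h' : L.Link q r) : L.Link p r := by
  obtain ⟨C, C', D, D', h₁, h₂, h₃, h₄, h₅⟩ := h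
  obtain ⟨B, B', A, A', k₁, k₂, k₃, k₄, k₅⟩ := h'
  refine ⟨C ++ B, B' ++ C', A ++ D, D' ++ A', fun w hw => ?_, fun w hw => ?_, fun w hw => ?_,
    fun w hw => ?_, fun w hw => ?_⟩
  · simpa using h₁ _ (k₁ w hw)
  · simpa using h₂ _ (k₂ w hw)
  · simpa using k₃ _ (h₃ w hw)
  · simpa using h₄ _ (k₄ w hw)
  · simpa using h₅ _ (k₅ w hw)

theorem EvaluatesTo.unit_append {w : List G} {g : G} (h : L.EvaluatesTo w g) {v : List G}
    (hv : L.EvaluatesTo v (L.u (L.t g))) : L.EvaluatesTo (v ++ w) g := by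
  simpa [L.unit_mul] using EvaluatesTo.mul hv h (L.unit_mul_mem g)

theorem EvaluatesTo.append_unit {w : List G} {g : G} (h : L.EvaluatesTo w g) {v : List G}
    (hv : L.EvaluatesTo v (L.u (L.s g))) : L.EvaluatesTo (w ++ v) g := by
  simpa [L.mul_unit] using EvaluatesTo.mul h hv (L.mul_unit_mem g)

theorem hasCommonExpansions_of_link
    (hL : ∀ c d, (c, d) ∈ L.mulDomain → L.Link (c, d) (L.u (L.s c), L.u (L.s c))) :
    L.HasCommonExpansions := by
  intro c d hcd w hw
  obtain ⟨C, C', D, D', h₁, h₂, h₃, h₄, h₅⟩ := hL c d hcd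
  simp only [L.t_u, L.s_u] at *
  have huu : L.mul (L.u (L.s c)) (L.u (L.s c)) = L.u (L.s c) := by
    simpa [L.s_u] using L.mul_unit (L.u (L.s c))
  rw [huu] at h₃
  set e := L.u (L.s c)
  have he : L.EvaluatesTo [e] e := .single e
  -- In one reading, `C e C'` is a unit absorbed by the first letter of `w` and `D' e D` a unit
  -- absorbed by the last. In the other, `C e` gives `c`, `C' w D'` gives the unit `e`, which `c`
  -- absorbs, and `e D` gives `d`.
  refine ⟨(C ++ [e] ++ C') ++ w ++ (D' ++ [e] ++ D), ?_, ?_⟩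
  · cases w with
    | nil => exact absurd rfl hw.ne_nil
    | cons g w =>
      have hl : L.t g = L.t c := by
        have := hw.isPath.1; rwa [L.t_mul _ _ hcd] at this
      have key : L.EvaluatesTo ((C ++ [e] ++ C') ++ [g]) g := by
        refine (EvaluatesTo.single g).unit_append ?_
        rw [hl]; exact h₄ _ he
      have hs : L.IsPath (L.t g) (g :: w) (L.s d) := by
        have := hw.isPath; rwa [L.t_mul _ _ hcd, L.s_mul _ _ hcd, ← hl] at this
      have := key.red.append (Red.refl w)
      obtain ⟨v, k, hvk⟩ : ∃ v k, g :: w = v ++ [k] :=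
        ⟨_, _, (List.dropLast_append_getLast (l := g :: w) (by simp)).symm⟩
      have hk : L.s k = L.s d := by
        rw [hvk, isPath_append] at hs
        obtain ⟨z, -, hz⟩ := hs
        exact hz.2
      have key' : L.EvaluatesTo ([k] ++ (D' ++ [e] ++ D)) k := by
        refine (EvaluatesTo.single k).append_unit ?_
        rw [hk]; exact h₅ _ he
      have h6 : L.Red ((g :: w) ++ (D' ++ [e] ++ D)) (g :: w) := by
        rw [hvk, List.append_assoc]
        exact (Red.refl v).append key'.red
      have h7 : L.Red ((C ++ [e] ++ C') ++ (g :: w)) (g :: w) := by simpa using this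
      rw [List.append_assoc]
      exact ((Red.refl _).append h6).trans h7
  · have hm : L.EvaluatesTo (C ++ [e] ++ (C' ++ w ++ D')) c := by
      refine (h₁ _ he).append_unit ?_
      exact h₃ _ hw
    have := hm.red.append (h₂ _ he).red
    simpa using this

end Words

end LocalLieGroupoid

/-! ### Smoothness on a neighborhood of a point -/

section SmoothNear

variable {E₁ H₁ E₂ H₂ E₃ H₃ : Type*}
  [NormedAddCommGroup E₁] [NormedSpace ℝ E₁] [TopologicalSpace H₁]
  [NormedAddCommGroup E₂] [NormedSpace ℝ E₂] [TopologicalSpace H₂]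
  [NormedAddCommGroup E₃] [NormedSpace ℝ E₃] [TopologicalSpace H₃]
  {I₁ : ModelWithCorners ℝ E₁ H₁} {I₂ : ModelWithCorners ℝ E₂ H₂} {I₃ : ModelWithCorners ℝ E₃ H₃}
  {P Q R : Type*} [TopologicalSpace P] [ChartedSpace H₁ P] [TopologicalSpace Q] [ChartedSpace H₂ Q]
  [TopologicalSpace R] [ChartedSpace H₃ R]

/-- The map `f` is smooth on a neighborhood of `p`. -/
def SmoothNear (I₁ : ModelWithCorners ℝ E₁ H₁) (I₂ : ModelWithCorners ℝ E₂ H₂) (f : P → Q) (p : P) :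
    Prop :=
  ∀ᶠ q in 𝓝 p, ContMDiffAt I₁ I₂ ∞ f q

theorem SmoothNear.contMDiffAt {f : P → Q} {p : P} (h : SmoothNear I₁ I₂ f p) :
    ContMDiffAt I₁ I₂ ∞ f p := h.self_of_nhds

theorem SmoothNear.continuousAt {f : P → Q} {p : P} (h : SmoothNear I₁ I₂ f p) :
    ContinuousAt f p := h.contMDiffAt.continuousAt

/-- `ContMDiffAt` of order `∞` at a single point only gives, for each finite order, a neighborhood
that may shrink with the order. Smoothness on one neighborhood passes to nearby points. -/
theorem SmoothNear.eventually {f : P → Q} {p : P} (h : SmoothNear I₁ I₂ f p) :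
    ∀ᶠ q in 𝓝 p, SmoothNear I₁ I₂ f q := eventually_eventually_nhds.2 h

theorem ContMDiff.smoothNear {f : P → Q} (h : ContMDiff I₁ I₂ ∞ f) (p : P) :
    SmoothNear I₁ I₂ f p := .of_forall fun q => h q

theorem ContMDiffOn.smoothNear {f : P → Q} {s : Set P} (h : ContMDiffOn I₁ I₂ ∞ f s) {p : P}
    (hs : s ∈ 𝓝 p) : SmoothNear I₁ I₂ f p := by
  filter_upwards [eventually_mem_nhds_iff.2 hs] with q hq
  exact h.contMDiffAt hq

theorem SmoothNear.comp_of_eq {g : Q → R} {f : P → Q} {p : P} {q : Q} (hg : SmoothNear I₂ I₃ g q)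
    (hf : SmoothNear I₁ I₂ f p) (h : f p = q) : SmoothNear I₁ I₃ (fun x => g (f x)) p := by
  subst h
  filter_upwards [hf, hf.continuousAt.eventually hg] with x hx hx'
  exact hx'.comp x hx

theorem SmoothNear.comp {g : Q → R} {f : P → Q} {p : P} (hg : SmoothNear I₂ I₃ g (f p))
    (hf : SmoothNear I₁ I₂ f p) : SmoothNear I₁ I₃ (fun x => g (f x)) p := hg.comp_of_eq hf rfl

theorem SmoothNear.prodMk {g : P → R} {f : P → Q} {p : P} (hf : SmoothNear I₁ I₂ f p)
    (hg : SmoothNear I₁ I₃ g p) : SmoothNear I₁ (I₂.prod I₃) (fun x => (f x, g x)) p := by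
  filter_upwards [hf, hg] with x hx hx'
  exact hx.prodMk hx'

theorem SmoothNear.congr {f g : P → Q} {p : P} (hf : SmoothNear I₁ I₂ f p) (h : f =ᶠ[𝓝 p] g) :
    SmoothNear I₁ I₂ g p := by
  filter_upwards [hf, h.eventuallyEq_nhds] with x hx hx'
  exact hx.congr_of_eventuallyEq hx'.symm

theorem smoothNear_const (c : Q) (p : P) : SmoothNear I₁ I₂ (fun _ => c) p :=
  contMDiff_const.smoothNear p

theorem smoothNear_id (p : P) : SmoothNear I₁ I₁ (fun x => x) p := contMDiff_id.smoothNear p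

theorem smoothNear_fst (p : P × Q) : SmoothNear (I₁.prod I₂) I₁ Prod.fst p :=
  contMDiff_fst.smoothNear p

theorem smoothNear_snd (p : P × Q) : SmoothNear (I₁.prod I₂) I₂ Prod.snd p :=
  contMDiff_snd.smoothNear p

theorem SmoothNear.mem_nhds {f : P → Q} {p : P} {q : Q} (hf : SmoothNear I₁ I₂ f p) (h : f p = q)
    {s : Q → Prop} (hs : ∀ᶠ y in 𝓝 q, s y) : ∀ᶠ x in 𝓝 p, s (f x) := by
  subst h; exact hf.continuousAt.eventually hs

end SmoothNear

/-! ### Normal forms of submersions and the implicit function theorem -/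

section NormalForm

variable {E F K : Type*} [NormedAddCommGroup E] [NormedSpace ℝ E] [NormedAddCommGroup F]
  [NormedSpace ℝ F] [NormedAddCommGroup K] [NormedSpace ℝ K]

/-- Adapted coordinates for a submersion: the fibers are locally parametrized by `K`. -/
theorem exists_submersion_coordinates
    {G : Type*} [TopologicalSpace G] [ChartedSpace E G] [IsManifold 𝓘(ℝ, E) ∞ G]
    {M : Type*} [TopologicalSpace M] [ChartedSpace F M] [IsManifold 𝓘(ℝ, F) ∞ M]
    {f : G → M} {g : G}
    (hf : Manifold.IsSubmersionAtOfComplement K 𝓘(ℝ, E) 𝓘(ℝ, F) ∞ f g) :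
    ∃ (κ : G → K) (Θ : M × K → G),
      SmoothNear 𝓘(ℝ, E) 𝓘(ℝ, K) κ g ∧
      SmoothNear (𝓘(ℝ, F).prod 𝓘(ℝ, K)) 𝓘(ℝ, E) Θ (f g, κ g) ∧
      Θ (f g, κ g) = g ∧ (∀ᶠ h in 𝓝 g, Θ (f h, κ h) = h) ∧
      (∀ᶠ q in 𝓝 (f g, κ g), f (Θ q) = q.1 ∧ κ (Θ q) = q.2) := by
  set φ := hf.domChart
  set ψ := hf.codChart
  set e := hf.equiv
  have hφ : g ∈ φ.source := hf.mem_domChart_source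
  have hψ : f g ∈ ψ.source := hf.mem_codChart_source
  have hφm := hf.domChart_mem_maximalAtlas
  have hψm := hf.codChart_mem_maximalAtlas
  have hloc : ∀ h ∈ φ.source, ψ (f h) = (e (φ h)).1 := by
    intro h hh
    have hh' : φ h ∈ (φ.extend 𝓘(ℝ, E)).target := by simpa using φ.map_source hh
    have hl : hf.domChart.symm (φ h) = h := φ.left_inv hh
    simpa [hl] using hf.writtenInCharts hh'
  have hmaps : ∀ h ∈ φ.source, f h ∈ ψ.source := fun h hh => hf.source_subset_preimage_source hh
  have hinv : ∀ h ∈ φ.source, φ.symm (e.symm (ψ (f h), (e (φ h)).2)) = h := by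
    intro h hh
    rw [hloc h hh, Prod.mk.eta, e.symm_apply_apply, φ.left_inv hh]
  have hφs : SmoothNear 𝓘(ℝ, E) 𝓘(ℝ, E) φ g :=
    (contMDiffOn_of_mem_maximalAtlas hφm).smoothNear (φ.open_source.mem_nhds hφ)
  have hψs : SmoothNear 𝓘(ℝ, F) 𝓘(ℝ, F) ψ (f g) :=
    (contMDiffOn_of_mem_maximalAtlas hψm).smoothNear (ψ.open_source.mem_nhds hψ)
  have hφs' : SmoothNear 𝓘(ℝ, E) 𝓘(ℝ, E) φ.symm (φ g) :=
    (contMDiffOn_symm_of_mem_maximalAtlas hφm).smoothNear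
      (φ.open_target.mem_nhds (φ.map_source hφ))
  have hpt : e.symm (ψ (f g), (e (φ g)).2) = φ g := by
    rw [hloc g hφ, Prod.mk.eta, e.symm_apply_apply]
  have hin : SmoothNear (𝓘(ℝ, F).prod 𝓘(ℝ, K)) 𝓘(ℝ, E) (fun q : M × K => e.symm (ψ q.1, q.2))
      (f g, (e (φ g)).2) := by
    have h1 : SmoothNear (𝓘(ℝ, F).prod 𝓘(ℝ, K)) (𝓘(ℝ, F).prod 𝓘(ℝ, K))
        (fun q : M × K => (ψ q.1, q.2)) (f g, (e (φ g)).2) :=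
      (hψs.comp_of_eq (smoothNear_fst _) rfl).prodMk (smoothNear_snd _)
    have h2 : ContMDiff (𝓘(ℝ, F).prod 𝓘(ℝ, K)) 𝓘(ℝ, E) ∞ e.symm := by
      rw [← modelWithCornersSelf_prod, chartedSpaceSelf_prod]
      exact e.symm.contDiff.contMDiff
    exact (h2.smoothNear _).comp_of_eq h1 rfl
  -- `κ` is the `K`-component of the domain chart; `Θ` inverts that chart after replacing the
  -- `F`-component by the coordinate of a point of `M`.
  refine ⟨fun h => (e (φ h)).2, fun q => φ.symm (e.symm (ψ q.1, q.2)), ?_, ?_, hinv g hφ, ?_, ?_⟩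
  · exact (((contDiff_snd (𝕜 := ℝ)).comp e.contDiff).contMDiff.smoothNear (φ g)).comp hφs
  · exact hφs'.comp_of_eq hin hpt
  · filter_upwards [φ.open_source.mem_nhds hφ] with h hh using hinv h hh
  · have h1 : ∀ᶠ q : M × K in 𝓝 (f g, (e (φ g)).2), q.1 ∈ ψ.source :=
      continuousAt_fst.eventually (ψ.open_source.mem_nhds hψ)
    have h2 : ∀ᶠ q : M × K in 𝓝 (f g, (e (φ g)).2), e.symm (ψ q.1, q.2) ∈ φ.target :=
      hin.mem_nhds hpt (φ.open_target.mem_nhds (φ.map_source hφ))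
    filter_upwards [h1, h2] with q hq1 hq2
    have h3 := φ.map_target hq2
    have h4 := φ.right_inv hq2
    refine ⟨ψ.injOn (hmaps _ h3) hq1 ?_, ?_⟩
    · rw [hloc _ h3, h4, e.apply_symm_apply]
    · simp [h4]

/-- A local solution of an equation depending smoothly on parameters. -/
theorem exists_implicit_function [FiniteDimensional ℝ E] [FiniteDimensional ℝ K] {f : E × K → K}
    {a : E} {b : K} (hf : SmoothNear 𝓘(ℝ, E × K) 𝓘(ℝ, K) f (a, b)) {f' : K →L[ℝ] K}
    (hf' : HasFDerivAt (fun v => f (a, v)) f' b) (hinj : Function.Injective f') :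
    ∃ V : E × K → K, SmoothNear 𝓘(ℝ, E × K) 𝓘(ℝ, K) V (a, f (a, b)) ∧ V (a, f (a, b)) = b ∧
      ∀ᶠ q in 𝓝 (a, f (a, b)), f (q.1, V q) = q.2 := by
  have hf0 : ContDiffAt ℝ ∞ f (a, b) := hf.contMDiffAt.contDiffAt
  set Φ : E × K → E × K := fun q => (q.1, f q) with hΦ
  have hΦs : ∀ᶠ q in 𝓝 (a, b), ContDiffAt ℝ ∞ Φ q := by
    filter_upwards [hf] with q hq
    exact contDiffAt_fst.prodMk hq.contDiffAt
  have hΦ0 : ContDiffAt ℝ ∞ Φ (a, b) := hΦs.self_of_nhds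
  set A := fderiv ℝ f (a, b)
  have hA : HasFDerivAt f A (a, b) := (hf0.differentiableAt (by simp)).hasFDerivAt
  have hΦd : HasFDerivAt Φ ((ContinuousLinearMap.fst ℝ E K).prod A) (a, b) :=
    hasFDerivAt_fst.prodMk hA
  have hA' : ∀ v, A (0, v) = f' v := by
    intro v
    have := hA.comp b ((hasFDerivAt_const a b).prodMk (hasFDerivAt_id b))
    have := this.unique hf'
    rw [← this]; simp
  have hi : Function.Injective ((ContinuousLinearMap.fst ℝ E K).prod A) := by
    rw [injective_iff_map_eq_zero]
    rintro ⟨e, v⟩ h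
    simp only [ContinuousLinearMap.prod_apply, ContinuousLinearMap.coe_fst', Prod.mk_eq_zero] at h
    obtain ⟨rfl, h⟩ := h
    rw [hA'] at h
    rw [(injective_iff_map_eq_zero f').1 hinj v h]; rfl
  set B : (E × K) ≃L[ℝ] (E × K) :=
    (LinearEquiv.ofInjectiveEndo ((ContinuousLinearMap.fst ℝ E K).prod A : E × K →ₗ[ℝ] E × K)
      hi).toContinuousLinearEquiv
  have hB : (B : E × K →L[ℝ] E × K) = (ContinuousLinearMap.fst ℝ E K).prod A := by
    exact ContinuousLinearMap.ext fun q => rfl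
  have hΦB : HasFDerivAt Φ (B : E × K →L[ℝ] E × K) (a, b) := by rw [hB]; exact hΦd
  set T := hΦ0.toOpenPartialHomeomorph Φ hΦB (by simp) with hT
  have hTc : ∀ q, T q = Φ q := fun q => rfl
  have hs : (a, b) ∈ T.source := hΦ0.mem_toOpenPartialHomeomorph_source hΦB (by simp)
  have ht : (a, f (a, b)) ∈ T.target := T.map_source hs
  have hTs : T.symm (a, f (a, b)) = (a, b) := T.left_inv hs
  have hc : ContinuousAt T.symm (a, f (a, b)) := T.continuousAt_symm ht
  -- The inverse has to be smooth on a whole neighborhood. Invertibility of the differential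
  -- persists because linear equivalences form an open set.
  have hequiv : ∀ᶠ q in 𝓝 (a, b), ∃ C : (E × K) ≃L[ℝ] (E × K),
      HasFDerivAt Φ (C : E × K →L[ℝ] E × K) q := by
    have h1 : ContinuousAt (fderiv ℝ Φ) (a, b) := hΦ0.continuousAt_fderiv (by simp)
    have h2 : Set.range ((↑) : ((E × K) ≃L[ℝ] (E × K)) → (E × K →L[ℝ] E × K)) ∈
        𝓝 (fderiv ℝ Φ (a, b)) := by
      rw [hΦB.fderiv]; exact B.nhds
    filter_upwards [h1.eventually h2, hΦs] with q ⟨C, hC⟩ hq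
    exact ⟨C, by rw [hC]; exact (hq.differentiableAt (by simp)).hasFDerivAt⟩
  have hsm : SmoothNear 𝓘(ℝ, E × K) 𝓘(ℝ, E × K) T.symm (a, f (a, b)) := by
    have h1 := hc.eventually (by rw [hTs]; exact hequiv.and hΦs)
    filter_upwards [h1, T.open_target.mem_nhds ht] with q ⟨⟨C, hC⟩, hq⟩ hqt
    exact (T.contDiffAt_symm hqt hC hq).contMDiffAt
  refine ⟨fun q => (T.symm q).2, ?_, by simp [hTs], ?_⟩
  · exact ((contDiff_snd (𝕜 := ℝ)).contMDiff.smoothNear _).comp hsm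
  · filter_upwards [T.open_target.mem_nhds ht] with q hq
    have h1 : Φ (T.symm q) = q := T.right_inv hq
    have h2 : (T.symm q).1 = q.1 := by simpa [hΦ] using congrArg Prod.fst h1
    have h3 : f (T.symm q) = q.2 := by simpa [hΦ] using congrArg Prod.snd h1
    rw [← h2]; exact h3

end NormalForm

/-! ### Smooth division for a partially defined multiplication -/

section Division

variable {E : Type*} [NormedAddCommGroup E] [NormedSpace ℝ E]
  {F : Type*} [NormedAddCommGroup F] [NormedSpace ℝ F]
  {G : Type*} [TopologicalSpace G] [ChartedSpace E G]
  {M : Type*}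

/-- A partially defined multiplication on a manifold `G`, smooth and defined near any element of
its domain on all pairs that are composable for `s` and `t`. -/
structure PartialMul (E : Type*) [NormedAddCommGroup E] [NormedSpace ℝ E]
    {G M : Type*} [TopologicalSpace G] [ChartedSpace E G]
    (s t : G → M) (mul : G → G → G) (U : Set (G × G)) : Prop where
  composable : ∀ p ∈ U, s p.1 = t p.2
  eventually_mem : ∀ p ∈ U, ∀ᶠ q in 𝓝 p, s q.1 = t q.2 → q ∈ U
  contMDiffOn : ContMDiffOn (𝓘(ℝ, E).prod 𝓘(ℝ, E)) 𝓘(ℝ, E) ∞ (fun p : G × G => mul p.1 p.2) U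
  source_mul : ∀ p ∈ U, s (mul p.1 p.2) = s p.2

variable {s t : G → M} {mul : G → G → G} {U : Set (G × G)}

/-- The domain is open only among composable pairs. Composability of the factors near `p` makes the
preimage of `U` a neighborhood, which turns `ContMDiffOn` into smoothness without restriction. -/
theorem PartialMul.smoothNear_mul (hm : PartialMul E s t mul U) {EP HP P : Type*}
    [NormedAddCommGroup EP] [NormedSpace ℝ EP]
    [TopologicalSpace HP] {I : ModelWithCorners ℝ EP HP} [TopologicalSpace P] [ChartedSpace HP P]
    {a b : P → G} {p : P} (ha : SmoothNear I 𝓘(ℝ, E) a p) (hb : SmoothNear I 𝓘(ℝ, E) b p)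
    (hp : (a p, b p) ∈ U) (hab : ∀ᶠ q in 𝓝 p, s (a q) = t (b q)) :
    SmoothNear I 𝓘(ℝ, E) (fun q => mul (a q) (b q)) p ∧ ∀ᶠ q in 𝓝 p, (a q, b q) ∈ U := by
  have h1 := (ha.prodMk hb).mem_nhds rfl (hm.eventually_mem _ hp)
  have h2 : ∀ᶠ q in 𝓝 p, (a q, b q) ∈ U := by
    filter_upwards [h1, hab] with q hq hq' using hq hq'
  refine ⟨?_, h2⟩
  filter_upwards [h2.eventually_nhds, ha.prodMk hb] with q hq hq'
  have h3 : ContMDiffWithinAt I 𝓘(ℝ, E) ∞ ((fun p : G × G => mul p.1 p.2) ∘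
      fun q => (a q, b q)) {q | (a q, b q) ∈ U} q :=
    (hm.contMDiffOn _ hq.self_of_nhds).comp q hq'.contMDiffWithinAt (fun _ h => h)
  exact h3.contMDiffAt hq

variable [TopologicalSpace M] [ChartedSpace F M]

/-- In adapted coordinates for `s` at `h` and at `h g`, right multiplication by `g` has an injective
differential, if `g` is right-regular. -/
theorem injective_of_regular {K K' : Type*} [NormedAddCommGroup K] [NormedSpace ℝ K]
    [NormedAddCommGroup K'] [NormedSpace ℝ K']
    (hm : PartialMul E s t mul U) {g : G} {c : K → G} {v : K} (hU : (c v, g) ∈ U)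
    (hreg : Set.BijOn
      (mfderivWithin 𝓘(ℝ, E) 𝓘(ℝ, E) (fun k => mul k g) {k | (k, g) ∈ U} (c v))
      {w | mfderiv 𝓘(ℝ, E) 𝓘(ℝ, F) s (c v) w = 0}
      {w | mfderiv 𝓘(ℝ, E) 𝓘(ℝ, F) s (mul (c v) g) w = 0})
    (hs : ∀ g, SmoothNear 𝓘(ℝ, E) 𝓘(ℝ, F) s g)
    (hc : SmoothNear 𝓘(ℝ, K) 𝓘(ℝ, E) c v) (hsc : ∀ᶠ w in 𝓝 v, s (c w) = t g)
    {κ : G → K} (hκ : SmoothNear 𝓘(ℝ, E) 𝓘(ℝ, K) κ (c v)) (hκc : ∀ᶠ w in 𝓝 v, κ (c w) = w)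
    {κ' : G → K'} (hκ' : SmoothNear 𝓘(ℝ, E) 𝓘(ℝ, K') κ' (mul (c v) g)) {Θ : M × K' → G}
    (hΘ : SmoothNear (𝓘(ℝ, F).prod 𝓘(ℝ, K')) 𝓘(ℝ, E) Θ (s (mul (c v) g), κ' (mul (c v) g)))
    (hΘκ : ∀ᶠ h in 𝓝 (mul (c v) g), Θ (s h, κ' h) = h)
    {f' : K →L[ℝ] K'} (hf' : HasFDerivAt (fun w => κ' (mul (c w) g)) f' v) :
    Function.Injective f' := by
  rw [injective_iff_map_eq_zero]
  intro ξ hξ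
  set S := {k | (k, g) ∈ U}
  have hcd : HasMFDerivAt 𝓘(ℝ, K) 𝓘(ℝ, E) c v (mfderiv 𝓘(ℝ, K) 𝓘(ℝ, E) c v) :=
    (hc.contMDiffAt.mdifferentiableAt (by simp)).hasMFDerivAt
  set c' := mfderiv 𝓘(ℝ, K) 𝓘(ℝ, E) c v
  have hRd : HasMFDerivWithinAt 𝓘(ℝ, E) 𝓘(ℝ, E) (fun k => mul k g) S (c v)
      (mfderivWithin 𝓘(ℝ, E) 𝓘(ℝ, E) (fun k => mul k g) S (c v)) := by
    have : ContMDiffWithinAt 𝓘(ℝ, E) 𝓘(ℝ, E) ∞ ((fun p : G × G => mul p.1 p.2) ∘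
        fun k => (k, g)) S (c v) :=
      (hm.contMDiffOn _ hU).comp (c v) (contMDiffWithinAt_id.prodMk contMDiffWithinAt_const)
        (fun _ h => h)
    exact (this.mdifferentiableWithinAt (by simp)).hasMFDerivWithinAt
  set R' := mfderivWithin 𝓘(ℝ, E) 𝓘(ℝ, E) (fun k => mul k g) S (c v)
  have hN : c ⁻¹' S ∈ 𝓝 v := by
    have := (hc.prodMk (smoothNear_const (I₂ := 𝓘(ℝ, E)) g v)).mem_nhds rfl
      (hm.eventually_mem _ hU)
    filter_upwards [this, hsc] with w hw hw' using hw hw'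
  have hRc : HasMFDerivAt 𝓘(ℝ, K) 𝓘(ℝ, E) (fun w => mul (c w) g) v (R'.comp c') :=
    (HasMFDerivWithinAt.comp v hRd (hcd.hasMFDerivWithinAt (s := c ⁻¹' S))
      (fun _ h => h)).hasMFDerivAt hN
  have hκd' : HasMFDerivAt 𝓘(ℝ, E) 𝓘(ℝ, K') κ' (mul (c v) g) _ :=
    (hκ'.contMDiffAt.mdifferentiableAt (by simp)).hasMFDerivAt
  have hsd : HasMFDerivAt 𝓘(ℝ, E) 𝓘(ℝ, F) s (c v) _ :=
    ((hs (c v)).contMDiffAt.mdifferentiableAt (by simp)).hasMFDerivAt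
  have hsd' : HasMFDerivAt 𝓘(ℝ, E) 𝓘(ℝ, F) s (mul (c v) g) _ :=
    ((hs (mul (c v) g)).contMDiffAt.mdifferentiableAt (by simp)).hasMFDerivAt
  have hκd : HasMFDerivAt 𝓘(ℝ, E) 𝓘(ℝ, K) κ (c v) _ :=
    (hκ.contMDiffAt.mdifferentiableAt (by simp)).hasMFDerivAt
  have hΘd := (hΘ.contMDiffAt.mdifferentiableAt (by simp)).hasMFDerivAt
  -- If `f' ξ = 0`, then `R' (c' ξ)` is killed by `dκ'` and also by `ds`, as `c` stays in a source
  -- fiber. Since `(s, κ')` are coordinates at the product, this vector vanishes; regularity gives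
  -- `c' ξ = 0`, and `κ ∘ c = id` gives `ξ = 0`.
  have h1 : mfderiv 𝓘(ℝ, E) 𝓘(ℝ, K') κ' (mul (c v) g) (R' (c' ξ)) = 0 := by
    have := hasMFDerivAt_unique (HasMFDerivAt.comp v hκd' hRc) hf'.hasMFDerivAt
    exact (DFunLike.congr_fun this ξ).trans hξ
  have h2 : c' ξ ∈ {w | mfderiv 𝓘(ℝ, E) 𝓘(ℝ, F) s (c v) w = 0} := by
    have := hasMFDerivAt_unique (HasMFDerivAt.comp v hsd hcd)
      ((hasMFDerivAt_const (I := 𝓘(ℝ, K)) (I' := 𝓘(ℝ, F)) (t g) v).congr_of_eventuallyEq hsc)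
    exact DFunLike.congr_fun this ξ
  have h3 : mfderiv 𝓘(ℝ, E) 𝓘(ℝ, F) s (mul (c v) g) (R' (c' ξ)) = 0 := hreg.mapsTo h2
  have h4 : R' (c' ξ) = 0 := by
    have := hasMFDerivAt_unique (HasMFDerivAt.comp (mul (c v) g) hΘd (hsd'.prodMk hκd'))
      ((hasMFDerivAt_id (I := 𝓘(ℝ, E)) (mul (c v) g)).congr_of_eventuallyEq hΘκ)
    have := DFunLike.congr_fun this (R' (c' ξ))
    refine Eq.trans this.symm ?_
    have h0 : (mfderiv 𝓘(ℝ, E) 𝓘(ℝ, F) s (mul (c v) g) (R' (c' ξ)),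
      mfderiv 𝓘(ℝ, E) 𝓘(ℝ, K') κ' (mul (c v) g) (R' (c' ξ))) = (0 : F × K') := Prod.ext h3 h1
    exact Eq.trans (congrArg (mfderiv (𝓘(ℝ, F).prod 𝓘(ℝ, K')) 𝓘(ℝ, E) Θ _) h0) (map_zero _)
  have h5 : c' ξ = 0 := hreg.injOn h2 (by simp) (h4.trans (map_zero R').symm)
  have := hasMFDerivAt_unique (HasMFDerivAt.comp v hκd hcd)
    ((hasMFDerivAt_id (I := 𝓘(ℝ, K)) v).congr_of_eventuallyEq hκc)
  have h6 := DFunLike.congr_fun this ξ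
  refine Eq.trans h6.symm ?_
  exact Eq.trans (congrArg (mfderiv 𝓘(ℝ, E) 𝓘(ℝ, K) κ (c v)) h5) (map_zero _)

variable [FiniteDimensional ℝ E] [IsManifold 𝓘(ℝ, E) ∞ G] [IsManifold 𝓘(ℝ, F) ∞ M]

/-- In fiber coordinates for `s`, right multiplication by `g` is a map `K → K` depending smoothly on
`g`. A submersion has one complement `K` for all points, so the injective differential given by
regularity is invertible, and the implicit function theorem solves for the left factor. -/
theorem PartialMul.exists_division (hm : PartialMul E s t mul U)
    (hs : Manifold.IsSubmersion 𝓘(ℝ, E) 𝓘(ℝ, F) ∞ s)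
    (ht : ∀ g, SmoothNear 𝓘(ℝ, E) 𝓘(ℝ, F) t g) {g h : G} (hU : (h, g) ∈ U)
    (hreg : Set.BijOn
      (mfderivWithin 𝓘(ℝ, E) 𝓘(ℝ, E) (fun k => mul k g) {k | (k, g) ∈ U} h)
      {w | mfderiv 𝓘(ℝ, E) 𝓘(ℝ, F) s h w = 0}
      {w | mfderiv 𝓘(ℝ, E) 𝓘(ℝ, F) s (mul h g) w = 0}) :
    ∃ D : G × G → G, D (mul h g, g) = h ∧
      SmoothNear (𝓘(ℝ, E).prod 𝓘(ℝ, E)) 𝓘(ℝ, E) D (mul h g, g) ∧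
      ∀ᶠ q in 𝓝 (mul h g, g), s q.1 = s q.2 → (D q, q.2) ∈ U ∧ mul (D q) q.2 = q.1 := by
  obtain ⟨K, _, _, hK⟩ := hs
  have hss : ∀ g, SmoothNear 𝓘(ℝ, E) 𝓘(ℝ, F) s g := fun g => .of_forall fun q =>
    (hK q).contMDiffAt
  have : FiniteDimensional ℝ K := by
    refine Module.Finite.of_surjective
      ((LinearMap.snd ℝ F K).comp (hK g).equiv.toLinearEquiv.toLinearMap) ?_
    exact Prod.snd_surjective.comp (hK g).equiv.surjective
  obtain ⟨κ₁, Θ₁, hκ₁, hΘ₁, hΘκ₁, -, hsκ₁⟩ := exists_submersion_coordinates (hK h)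
  obtain ⟨κ₂, Θ₂, hκ₂, hΘ₂, hΘκ₂, hΘκ₂', hsκ₂⟩ := exists_submersion_coordinates (hK (mul h g))
  have hst : s h = t g := hm.composable _ hU
  rw [hst] at hΘ₁ hΘκ₁ hsκ₁
  -- the family of factors, in terms of the right factor and of the fiber coordinate
  have hkin : SmoothNear (𝓘(ℝ, E).prod 𝓘(ℝ, K)) (𝓘(ℝ, F).prod 𝓘(ℝ, K))
      (fun q : G × K => (t q.1, q.2)) (g, κ₁ h) :=
    ((ht g).comp_of_eq (smoothNear_fst _) rfl).prodMk (smoothNear_snd _)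
  set k : G × K → G := fun q => Θ₁ (t q.1, q.2) with hk
  have hks : SmoothNear (𝓘(ℝ, E).prod 𝓘(ℝ, K)) 𝓘(ℝ, E) k (g, κ₁ h) := hΘ₁.comp_of_eq hkin rfl
  have hk0 : k (g, κ₁ h) = h := hΘκ₁
  have hkst : ∀ᶠ q in 𝓝 (g, κ₁ h), s (k q) = t q.1 := by
    filter_upwards [hkin.mem_nhds rfl hsκ₁] with q hq using hq.1
  obtain ⟨hms, hmU⟩ := hm.smoothNear_mul hks (smoothNear_fst _) (by rw [hk0]; exact hU) hkst
  have hψs : SmoothNear (𝓘(ℝ, E).prod 𝓘(ℝ, K)) 𝓘(ℝ, K)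
      (fun q : G × K => κ₂ (mul (k q) q.1)) (g, κ₁ h) := hκ₂.comp_of_eq hms (by rw [hk0])
  set φ := chartAt E g
  have hφ : SmoothNear 𝓘(ℝ, E) 𝓘(ℝ, E) φ g :=
    (contMDiffOn_chart (n := ∞)).smoothNear (φ.open_source.mem_nhds (mem_chart_source E g))
  have hφ' : SmoothNear 𝓘(ℝ, E) 𝓘(ℝ, E) φ.symm (φ g) :=
    (contMDiffOn_chart_symm (n := ∞)).smoothNear (φ.open_target.mem_nhds (mem_chart_target E g))
  have hφg : φ.symm (φ g) = g := φ.left_inv (mem_chart_source E g)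
  have hin : SmoothNear 𝓘(ℝ, E × K) (𝓘(ℝ, E).prod 𝓘(ℝ, K))
      (fun q : E × K => (φ.symm q.1, q.2)) (φ g, κ₁ h) :=
    (hφ'.comp_of_eq ((contDiff_fst (𝕜 := ℝ)).contMDiff.smoothNear _) rfl).prodMk
      ((contDiff_snd (𝕜 := ℝ)).contMDiff.smoothNear _)
  set f : E × K → K := fun q => κ₂ (mul (k (φ.symm q.1, q.2)) (φ.symm q.1)) with hf
  have hfs : SmoothNear 𝓘(ℝ, E × K) 𝓘(ℝ, K) f (φ g, κ₁ h) :=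
    hψs.comp_of_eq hin (by simp only [hφg])
  have hf0 : f (φ g, κ₁ h) = κ₂ (mul h g) := by simp only [hf, hφg, hk0]
  -- the curve of factors for a fixed right factor
  set c : K → G := fun v => Θ₁ (t g, v) with hc
  have hc0 : c (κ₁ h) = h := hΘκ₁
  have hcin : SmoothNear 𝓘(ℝ, K) (𝓘(ℝ, F).prod 𝓘(ℝ, K)) (fun v : K => (t g, v)) (κ₁ h) :=
    (smoothNear_const _ _).prodMk (smoothNear_id _)
  have hcs : SmoothNear 𝓘(ℝ, K) 𝓘(ℝ, E) c (κ₁ h) := hΘ₁.comp_of_eq hcin rfl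
  have hsc := hcin.mem_nhds rfl hsκ₁
  have hfc : (fun v => f (φ g, v)) = fun v => κ₂ (mul (c v) g) := by
    funext v; simp only [hf, hφg]; rfl
  have hfd : HasFDerivAt (fun v => f (φ g, v)) (fderiv ℝ (fun v => f (φ g, v)) (κ₁ h)) (κ₁ h) := by
    have : DifferentiableAt ℝ f (φ g, κ₁ h) :=
      hfs.contMDiffAt.contDiffAt.differentiableAt (by simp)
    exact (this.comp (f := fun v => (φ g, v)) (κ₁ h) (by fun_prop)).hasFDerivAt
  have hinj := injective_of_regular hm (K := K) (K' := K) (g := g) (c := c) (v := κ₁ h)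
    (by rw [hc0]; exact hU) (by rw [hc0]; exact hreg) hss hcs (hsc.mono fun _ h => h.1)
    (by rw [hc0]; exact hκ₁) (hsc.mono fun _ h => h.2) (κ' := κ₂) (by rw [hc0]; exact hκ₂)
    (Θ := Θ₂) (by rw [hc0]; exact hΘ₂) (by rw [hc0]; exact hΘκ₂') (by rw [← hfc]; exact hfd)
  obtain ⟨V, hV, hV0, hVf⟩ := exists_implicit_function hfs hfd hinj
  rw [hf0] at hV hV0 hVf
  have hin' : SmoothNear (𝓘(ℝ, E).prod 𝓘(ℝ, E)) 𝓘(ℝ, E × K)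
      (fun q : G × G => (φ q.2, κ₂ q.1)) (mul h g, g) := by
    have := (hφ.comp_of_eq (smoothNear_snd (I₁ := 𝓘(ℝ, E)) (mul h g, g)) rfl).prodMk
      (hκ₂.comp_of_eq (smoothNear_fst (I₂ := 𝓘(ℝ, E)) (mul h g, g)) rfl)
    rwa [← modelWithCornersSelf_prod, chartedSpaceSelf_prod] at this
  have hD' : SmoothNear (𝓘(ℝ, E).prod 𝓘(ℝ, E)) (𝓘(ℝ, E).prod 𝓘(ℝ, K))
      (fun q : G × G => (q.2, V (φ q.2, κ₂ q.1))) (mul h g, g) :=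
    (smoothNear_snd _).prodMk (hV.comp_of_eq hin' rfl)
  have hD : SmoothNear (𝓘(ℝ, E).prod 𝓘(ℝ, E)) 𝓘(ℝ, E)
      (fun q : G × G => k (q.2, V (φ q.2, κ₂ q.1))) (mul h g, g) :=
    hks.comp_of_eq hD' (by simp only [hV0])
  refine ⟨_, by simp only [hV0, hk0], hD, ?_⟩
  have e1 := hD'.mem_nhds (by simp only [hV0]) hmU
  have e2 := (hms.comp_of_eq hD' (by simp only [hV0])).mem_nhds
    (by simp only [hV0, hk0]) hΘκ₂'
  have e3 := hin'.mem_nhds rfl hVf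
  have e4 : ∀ᶠ q in 𝓝 (mul h g, g), q.2 ∈ φ.source :=
    continuousAt_snd.eventually (φ.open_source.mem_nhds (mem_chart_source E g))
  have e5 : ∀ᶠ q in 𝓝 (mul h g, g), Θ₂ (s q.1, κ₂ q.1) = q.1 :=
    (continuous_fst.tendsto (mul h g, g)).eventually hΘκ₂'
  filter_upwards [e1, e2, e3, e4, e5] with q h1 h2 h3 h4 h5 hq
  refine ⟨h1, ?_⟩
  simp only [hf, φ.left_inv h4] at h3
  -- The product and `q.1` have the same fiber coordinate by the choice of `V` and the same source
  -- by hypothesis, so `Θ₂` identifies them.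
  rw [← h2, h3, hm.source_mul _ h1, ← hq, h5]

end Division

/-! ### Division in a bi-regular local Lie groupoid -/

namespace LocalLieGroupoid

section

variable {E : Type uE} [NormedAddCommGroup E] [NormedSpace ℝ E]
  {F : Type uF} [NormedAddCommGroup F] [NormedSpace ℝ F]
  {G : Type uG} [TopologicalSpace G] [ChartedSpace E G]
  {M : Type uM} [TopologicalSpace M] [ChartedSpace F M]
  (L : LocalLieGroupoid E F G M)

theorem smoothNear_s (g : G) : SmoothNear 𝓘(ℝ, E) 𝓘(ℝ, F) L.s g :=
  .of_forall L.isSubmersion_s.contMDiff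

theorem smoothNear_t (g : G) : SmoothNear 𝓘(ℝ, E) 𝓘(ℝ, F) L.t g :=
  .of_forall L.isSubmersion_t.contMDiff

theorem partialMul : PartialMul E L.s L.t L.mul L.mulDomain where
  composable _ hp := mem_composable hp
  eventually_mem p hp := by
    obtain ⟨O, hO, hU⟩ := L.mulDomain_open
    rw [hU] at hp ⊢
    filter_upwards [hO.mem_nhds hp.1] with q hq hq' using ⟨hq, hq'⟩
  contMDiffOn := L.contMDiffOn_mul
  source_mul p hp := L.s_mul _ _ hp

/-- The opposite multiplication exchanges source and target, so left division is right division for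
the opposite structure. -/
theorem partialMul_swap :
    PartialMul E L.t L.s (fun g h => L.mul h g) (Prod.swap ⁻¹' L.mulDomain) where
  composable _ hp := (mem_composable hp).symm
  eventually_mem p hp := by
    have := continuous_swap.continuousAt.eventually (L.partialMul.eventually_mem p.swap hp)
    filter_upwards [this] with q hq hq' using hq hq'.symm
  contMDiffOn := L.contMDiffOn_mul.comp
    (contMDiff_snd.prodMk contMDiff_fst).contMDiffOn (fun _ h => h)
  source_mul p hp := L.t_mul _ _ hp

variable [FiniteDimensional ℝ E] [IsManifold 𝓘(ℝ, E) ∞ G] [IsManifold 𝓘(ℝ, F) ∞ M]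

variable {L}

/-- Smooth right division: `D (l, g) g = l`. -/
theorem BiRegular.exists_right_division (hL : L.BiRegular) {g h : G} (hU : (h, g) ∈ L.mulDomain) :
    ∃ D : G × G → G, D (L.mul h g, g) = h ∧
      SmoothNear (𝓘(ℝ, E).prod 𝓘(ℝ, E)) 𝓘(ℝ, E) D (L.mul h g, g) ∧
      ∀ᶠ q in 𝓝 (L.mul h g, g), L.s q.1 = L.s q.2 →
        (D q, q.2) ∈ L.mulDomain ∧ L.mul (D q) q.2 = q.1 :=
  L.partialMul.exists_division L.isSubmersion_s L.smoothNear_t hU ((hL g).2 h hU)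

/-- Smooth left division: `g D (l, g) = l`. -/
theorem BiRegular.exists_left_division (hL : L.BiRegular) {g h : G} (hU : (g, h) ∈ L.mulDomain) :
    ∃ D : G × G → G, D (L.mul g h, g) = h ∧
      SmoothNear (𝓘(ℝ, E).prod 𝓘(ℝ, E)) 𝓘(ℝ, E) D (L.mul g h, g) ∧
      ∀ᶠ q in 𝓝 (L.mul g h, g), L.t q.1 = L.t q.2 →
        (q.2, D q) ∈ L.mulDomain ∧ L.mul q.2 (D q) = q.1 :=
  L.partialMul_swap.exists_division L.isSubmersion_t L.smoothNear_s hU ((hL g).1 h hU)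

end

/-! ### Small factors, propagation of links, and generation by invertible arrows -/

section Malcev

variable {E : Type uE} [NormedAddCommGroup E] [NormedSpace ℝ E]
  {F : Type uF} [NormedAddCommGroup F] [NormedSpace ℝ F]
  {G : Type uG} [TopologicalSpace G] [ChartedSpace E G]
  {M : Type uM} [TopologicalSpace M] [ChartedSpace F M]
  {L : LocalLieGroupoid E F G M}

theorem mul_u_of_eq {g : G} {x : M} (h : L.s g = x) : (g, L.u x) ∈ L.mulDomain ∧ L.mul g (L.u x) = g := by
  subst h; exact ⟨L.mul_unit_mem g, L.mul_unit g⟩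

theorem u_mul_of_eq {g : G} {x : M} (h : L.t g = x) : (L.u x, g) ∈ L.mulDomain ∧ L.mul (L.u x) g = g := by
  subst h; exact ⟨L.unit_mul_mem g, L.unit_mul g⟩

theorem inv_mul_mem {a : G} (ha : a ∈ L.invDomain) : (L.inv a, a) ∈ L.mulDomain :=
  L.invDomain_mul _ (L.inv_mem a ha) _ ha (L.s_inv a ha)

theorem mul_inv_mem {a : G} (ha : a ∈ L.invDomain) : (a, L.inv a) ∈ L.mulDomain :=
  L.invDomain_mul _ ha _ (L.inv_mem a ha) (L.t_inv a ha).symm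

/-- Together with continuity of the inversion, this makes inverses of small arrows small. -/
theorem inv_u (x : M) : L.inv (L.u x) = L.u x := by
  have h := L.inv_mul _ (L.unit_mem_invDomain x)
  have h' := L.s_inv _ (L.unit_mem_invDomain x)
  rw [L.t_u] at h'
  rwa [(mul_u_of_eq h').2, L.s_u] at h

theorem GloballyAssociative.assoc (hA : L.GloballyAssociative) {a b c : G}
    (h₁ : (a, b) ∈ L.mulDomain) (h₂ : (L.mul a b, c) ∈ L.mulDomain) (h₃ : (b, c) ∈ L.mulDomain)
    (h₄ : (a, L.mul b c) ∈ L.mulDomain) : L.mul (L.mul a b) c = L.mul a (L.mul b c) :=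
  hA.unique (.mul (w₁ := [a, b]) (.mul (.single a) (.single b) h₁) (.single c) h₂)
    (.mul (w₁ := [a]) (.single a) (.mul (.single b) (.single c) h₃) h₄)

theorem GloballyAssociative.inv_mul_cancel (hA : L.GloballyAssociative) {a g : G}
    (ha : a ∈ L.invDomain) (hag : (a, g) ∈ L.mulDomain) (h : (L.inv a, L.mul a g) ∈ L.mulDomain) :
    L.mul (L.inv a) (L.mul a g) = g := by
  have h1 := u_mul_of_eq (mem_composable hag).symm
  rw [← hA.assoc (inv_mul_mem ha) (by rw [L.inv_mul a ha]; exact h1.1) hag h, L.inv_mul a ha, h1.2]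

theorem GloballyAssociative.mul_inv_cancel (hA : L.GloballyAssociative) {g b : G}
    (hb : b ∈ L.invDomain) (hgb : (g, b) ∈ L.mulDomain) (h : (L.mul g b, L.inv b) ∈ L.mulDomain) :
    L.mul (L.mul g b) (L.inv b) = g := by
  have h1 := mul_u_of_eq (mem_composable hgb)
  rw [hA.assoc hgb h (mul_inv_mem hb) (by rw [L.mul_inv b hb]; exact h1.1), L.mul_inv b hb, h1.2]

/-- The linking words are the single letters `a`, `b` and their inverses. The numbered hypotheses
only say that certain products are defined, which is automatic for `a`, `b` near units; the
equalities come from global associativity by exhibiting two bracketings of one word. -/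
theorem GloballyAssociative.link (hA : L.GloballyAssociative) {g h a b : G}
    (ha : a ∈ L.invDomain) (hb : b ∈ L.invDomain) (hgh : (g, h) ∈ L.mulDomain)
    (hag : (a, g) ∈ L.mulDomain) (hhb : (h, b) ∈ L.mulDomain)
    (h₁ : (L.mul a g, L.mul h b) ∈ L.mulDomain) (h₂ : (L.inv a, L.mul a g) ∈ L.mulDomain)
    (h₃ : (L.mul h b, L.inv b) ∈ L.mulDomain) (h₄ : (a, L.mul g h) ∈ L.mulDomain)
    (h₅ : (L.mul a (L.mul g h), b) ∈ L.mulDomain) (h₆ : (L.mul g h, b) ∈ L.mulDomain)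
    (h₇ : (L.mul (L.mul g h) b, L.inv b) ∈ L.mulDomain)
    (h₈ : (L.inv a, L.mul (L.mul a g) (L.mul h b)) ∈ L.mulDomain) :
    L.Link (g, h) (L.mul a g, L.mul h b) ∧ L.Link (L.mul a g, L.mul h b) (g, h) := by
  have ev : ∀ x, L.EvaluatesTo [x] x := .single
  have k₁ : L.EvaluatesTo [a, g, h, b] (L.mul (L.mul a g) (L.mul h b)) :=
    .mul (w₁ := [a, g]) (.mul (ev a) (ev g) hag) (.mul (ev h) (ev b) hhb) h₁
  have k₂ : L.mul (L.mul a g) (L.mul h b) = L.mul (L.mul a (L.mul g h)) b :=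
    hA.unique k₁ (.mul (w₁ := [a, g, h]) (.mul (w₁ := [a]) (ev a) (.mul (ev g) (ev h) hgh) h₄)
      (ev b) h₅)
  have k₃ : L.mul (L.inv a) (L.mul (L.mul a g) (L.mul h b)) = L.mul (L.mul g h) b := by
    have e₁ : L.t (L.mul (L.mul g h) b) = L.s a := by
      rw [L.t_mul _ _ h₆, L.t_mul _ _ hgh, mem_composable hag]
    refine hA.unique (.mul (ev (L.inv a)) k₁ h₈) (w := [L.inv a, a, g, h, b]) ?_
    have := EvaluatesTo.mul (w₁ := [L.inv a, a]) (.mul (ev _) (ev _) (inv_mul_mem ha))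
      (.mul (w₁ := [g, h]) (.mul (ev g) (ev h) hgh) (ev b) h₆)
      (by rw [L.inv_mul a ha]; exact (u_mul_of_eq e₁).1)
    rw [L.inv_mul a ha, (u_mul_of_eq e₁).2] at this
    exact this
  have k₄ := hA.mul_inv_cancel hb h₆ h₇
  have k₅ := hA.inv_mul_cancel ha hag h₂
  have k₆ := hA.mul_inv_cancel hb hhb h₃
  have c₁ := mem_composable hag
  have c₂ := mem_composable hhb
  have s₁ := mul_u_of_eq c₁
  have s₂ := u_mul_of_eq c₂.symm
  constructor
  · refine ⟨[L.inv a], [a], [L.inv b], [b], fun w hw => ?_, fun w hw => ?_, fun w hw => ?_,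
      fun w hw => ?_, fun w hw => ?_⟩
    · simpa [k₅] using EvaluatesTo.mul (ev _) hw h₂
    · simpa [k₆] using EvaluatesTo.mul hw (ev _) h₃
    · simpa [k₂] using EvaluatesTo.mul (EvaluatesTo.mul (ev _) hw h₄) (ev _) h₅
    · rw [L.t_mul _ _ hag] at hw
      have s₃ := mul_u_of_eq (L.s_inv a ha)
      have := EvaluatesTo.mul (EvaluatesTo.mul (ev _) hw s₃.1) (ev a)
        (by rw [s₃.2]; exact inv_mul_mem ha)
      rwa [s₃.2, L.inv_mul a ha, c₁] at this
    · rw [L.s_mul _ _ hhb] at hw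
      have s₃ := mul_u_of_eq (L := L) (g := b) rfl
      have := EvaluatesTo.mul (EvaluatesTo.mul (ev _) hw s₃.1) (ev (L.inv b))
        (by rw [s₃.2]; exact mul_inv_mem hb)
      rwa [s₃.2, L.mul_inv b hb, ← c₂] at this
  · refine ⟨[a], [L.inv a], [b], [L.inv b], fun w hw => .mul (ev a) hw hag,
      fun w hw => .mul hw (ev b) hhb, fun w hw => ?_, fun w hw => ?_, fun w hw => ?_⟩
    · have := EvaluatesTo.mul (EvaluatesTo.mul (ev _) hw h₈) (ev (L.inv b))
        (by rw [k₃]; exact h₇)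
      rwa [k₃, k₄] at this
    · simp only [L.t_mul _ _ hag] at hw ⊢
      have := EvaluatesTo.mul (EvaluatesTo.mul (ev _) hw s₁.1) (ev (L.inv a))
        (by rw [s₁.2]; exact mul_inv_mem ha)
      rwa [s₁.2, L.mul_inv a ha] at this
    · simp only [L.s_mul _ _ hhb] at hw ⊢
      have s₃ := mul_u_of_eq (L := L) (L.s_inv b hb)
      rw [c₂] at hw
      have := EvaluatesTo.mul (EvaluatesTo.mul (ev _) hw s₃.1) (ev b)
        (by rw [s₃.2]; exact inv_mul_mem hb)
      rwa [s₃.2, L.inv_mul b hb] at this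

theorem tendsto_mul {α : Type*} {l : Filter α} {a b : α → G} {p : G × G} (hp : p ∈ L.mulDomain)
    (ha : Filter.Tendsto a l (𝓝 p.1)) (hb : Filter.Tendsto b l (𝓝 p.2))
    (h : ∀ᶠ i in l, L.s (a i) = L.t (b i)) :
    (∀ᶠ i in l, (a i, b i) ∈ L.mulDomain) ∧
      Filter.Tendsto (fun i => L.mul (a i) (b i)) l (𝓝 (L.mul p.1 p.2)) := by
  have h1 : Filter.Tendsto (fun i => (a i, b i)) l (𝓝 p) := ha.prodMk_nhds hb
  have h2 : ∀ᶠ i in l, (a i, b i) ∈ L.mulDomain := by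
    filter_upwards [h1.eventually (L.partialMul.eventually_mem p hp), h] with i hi hi' using hi hi'
  exact ⟨h2, (L.contMDiffOn_mul p hp).continuousWithinAt.tendsto.comp
    (tendsto_nhdsWithin_iff.2 ⟨h1, h2⟩)⟩

theorem tendsto_inv {α : Type*} {l : Filter α} {a : α → G} {x : M}
    (ha : Filter.Tendsto a l (𝓝 (L.u x))) : Filter.Tendsto (fun i => L.inv (a i)) l (𝓝 (L.u x)) := by
  have := (L.contMDiffOn_inv.contMDiffAt
    (L.invDomain_open.mem_nhds (L.unit_mem_invDomain x))).continuousAt.tendsto.comp ha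
  rwa [inv_u] at this

variable [FiniteDimensional ℝ E] [IsManifold 𝓘(ℝ, E) ∞ G] [IsManifold 𝓘(ℝ, F) ∞ M]

/-- This is right division near the product `u (t g) · g = g`: by continuity the quotient of a
nearby arrow by `g` is close to the unit. -/
theorem BiRegular.exists_small_left_factor (hB : L.BiRegular) (g : G) :
    ∃ a : G → G, Filter.Tendsto a (𝓝 g) (𝓝 (L.u (L.t g))) ∧
      ∀ᶠ g' in 𝓝 g, L.s g' = L.s g → (a g', g) ∈ L.mulDomain ∧ L.mul (a g') g = g' := by
  obtain ⟨D, hD, hDs, hDm⟩ := hB.exists_right_division (L.unit_mul_mem g)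
  rw [L.unit_mul] at hD hDs hDm
  have h : Filter.Tendsto (fun g' => (g', g)) (𝓝 g) (𝓝 (g, g)) :=
    Filter.tendsto_id.prodMk_nhds tendsto_const_nhds
  refine ⟨fun g' => D (g', g), ?_, h.eventually hDm⟩
  have := hDs.continuousAt.tendsto.comp h
  rwa [hD] at this

theorem BiRegular.exists_small_right_factor (hB : L.BiRegular) (g : G) :
    ∃ b : G → G, Filter.Tendsto b (𝓝 g) (𝓝 (L.u (L.s g))) ∧
      ∀ᶠ g' in 𝓝 g, L.t g' = L.t g → (g, b g') ∈ L.mulDomain ∧ L.mul g (b g') = g' := by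
  obtain ⟨D, hD, hDs, hDm⟩ := hB.exists_left_division (L.mul_unit_mem g)
  rw [L.mul_unit] at hD hDs hDm
  have h : Filter.Tendsto (fun g' => (g', g)) (𝓝 g) (𝓝 (g, g)) :=
    Filter.tendsto_id.prodMk_nhds tendsto_const_nhds
  refine ⟨fun g' => D (g', g), ?_, h.eventually hDm⟩
  have := hDs.continuousAt.tendsto.comp h
  rwa [hD] at this

/-- Fixing `x` keeps `q.1` in the source fiber of `g` and `q.2` in the target fiber of `h`, so `q.1
= a g` and `q.2 = h b` with `a`, `b` near units. In the limit the products needed become `g h` or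
products with units, which are defined, so they are defined nearby. -/
theorem GloballyAssociative.eventually_link (hA : L.GloballyAssociative) (hB : L.BiRegular)
    {x : M} {p : G × G} (hp : p ∈ {p : G × G | p ∈ L.mulDomain ∧ L.s p.1 = x ∧ L.t p.2 = x}) :
    ∀ᶠ q in 𝓝[{p : G × G | p ∈ L.mulDomain ∧ L.s p.1 = x ∧ L.t p.2 = x}] p,
      L.Link p q ∧ L.Link q p := by
  obtain ⟨g, h⟩ := p
  obtain ⟨hgh, hx, hx'⟩ := hp
  simp only at hx hx'
  set l := 𝓝[{p : G × G | p ∈ L.mulDomain ∧ L.s p.1 = x ∧ L.t p.2 = x}] (g, h)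
  obtain ⟨a, ha, ham⟩ := hB.exists_small_left_factor g
  obtain ⟨b, hb, hbm⟩ := hB.exists_small_right_factor h
  have l₁ : Filter.Tendsto (fun q : G × G => q.1) l (𝓝 g) :=
    (continuous_fst.tendsto (g, h)).mono_left nhdsWithin_le_nhds
  have l₂ : Filter.Tendsto (fun q : G × G => q.2) l (𝓝 h) :=
    (continuous_snd.tendsto (g, h)).mono_left nhdsWithin_le_nhds
  have hl : ∀ᶠ q in l, q.1 = q.1 ∧ q ∈ L.mulDomain ∧ L.s q.1 = x ∧ L.t q.2 = x := by
    filter_upwards [self_mem_nhdsWithin] with q hq using ⟨rfl, hq⟩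
  have ha' := ha.comp l₁
  have hb' := hb.comp l₂
  have ia := tendsto_inv ha'
  have ib := tendsto_inv hb'
  have fa : ∀ᶠ q in l, (a q.1, g) ∈ L.mulDomain ∧ L.mul (a q.1) g = q.1 := by
    filter_upwards [l₁.eventually ham, hl] with q h1 h2 using h1 (h2.2.2.1.trans hx.symm)
  have fb : ∀ᶠ q in l, (h, b q.2) ∈ L.mulDomain ∧ L.mul h (b q.2) = q.2 := by
    filter_upwards [l₂.eventually hbm, hl] with q h1 h2 using h1 (h2.2.2.2.trans hx'.symm)
  have va : ∀ᶠ q in l, a q.1 ∈ L.invDomain :=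
    ha'.eventually (L.invDomain_open.mem_nhds (L.unit_mem_invDomain _))
  have vb : ∀ᶠ q in l, b q.2 ∈ L.invDomain :=
    hb'.eventually (L.invDomain_open.mem_nhds (L.unit_mem_invDomain _))
  have e₂ := (tendsto_mul (L.unit_mul_mem g) ia l₁ (by
    filter_upwards [va, fa] with q h1 h2
    rw [Function.comp_apply, L.s_inv _ h1, ← h2.2, L.t_mul _ _ h2.1, h2.2])).1
  have e₃ := (tendsto_mul (L.mul_unit_mem h) l₂ ib (by
    filter_upwards [vb, fb] with q h1 h2
    rw [Function.comp_apply, L.t_inv _ h1, ← h2.2, L.s_mul _ _ h2.1, h2.2])).1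
  have u₁ : (L.u (L.t g), L.mul g h) ∈ L.mulDomain := (u_mul_of_eq (L.t_mul _ _ hgh)).1
  have u₁' : L.mul (L.u (L.t g)) (L.mul g h) = L.mul g h := (u_mul_of_eq (L.t_mul _ _ hgh)).2
  have u₂ : (L.mul g h, L.u (L.s h)) ∈ L.mulDomain := (mul_u_of_eq (L.s_mul _ _ hgh)).1
  have u₂' : L.mul (L.mul g h) (L.u (L.s h)) = L.mul g h := (mul_u_of_eq (L.s_mul _ _ hgh)).2
  have e₄ := tendsto_mul u₁ ha' (tendsto_const_nhds (x := L.mul g h)) (by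
    filter_upwards [fa] with q h1
    exact (mem_composable h1.1).trans (L.t_mul _ _ hgh).symm)
  have e₅ := tendsto_mul (p := (L.mul g h, L.u (L.s h))) u₂ (u₁' ▸ e₄.2) hb' (by
    filter_upwards [e₄.1, fb] with q h1 h2
    rw [L.s_mul _ _ h1, L.s_mul _ _ hgh]
    exact mem_composable h2.1)
  have e₆ := tendsto_mul u₂ (tendsto_const_nhds (x := L.mul g h)) hb' (by
    filter_upwards [fb] with q h1
    exact (L.s_mul _ _ hgh).trans (mem_composable h1.1))
  have e₇ := tendsto_mul (p := (L.mul g h, L.u (L.s h))) u₂ (u₂' ▸ e₆.2) ib (by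
    filter_upwards [e₆.1, vb] with q h1 h2
    rw [L.s_mul _ _ h1, Function.comp_apply, L.t_inv _ h2])
  have e₈ := tendsto_mul hgh l₁ l₂ (by
    filter_upwards [hl] with q h1 using h1.2.2.1.trans h1.2.2.2.symm)
  have e₉ := tendsto_mul (p := (L.u (L.t g), L.mul g h)) u₁ ia e₈.2 (by
    filter_upwards [e₈.1, va, fa] with q h1 h2 h3
    rw [L.t_mul _ _ h1, Function.comp_apply, L.s_inv _ h2, ← L.t_mul _ _ h3.1, h3.2])
  filter_upwards [hl, fa, fb, va, vb, e₂, e₃, e₄.1, e₅.1, e₆.1, e₇.1, e₉.1] with q k₀ k₁ k₂ k₃ k₄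
    k₅ k₆ k₇ k₈ k₉ k₁₀ k₁₁
  have := hA.link k₃ k₄ hgh k₁.1 k₂.1 (by rw [k₁.2, k₂.2]; exact k₀.2.1) (by rw [k₁.2]; exact k₅)
    (by rw [k₂.2]; exact k₆) k₇ k₈ k₉ k₁₀ (by rw [k₁.2, k₂.2]; exact k₁₁)
  rwa [k₁.2, k₂.2] at this

/-- Links compose and join nearby pairs in both directions, so over a fixed unit connectedness links
every composable pair to the pair of units. -/
theorem StronglyConnected.hasCommonExpansions (hL : L.StronglyConnected)
    (hA : L.GloballyAssociative) : L.HasCommonExpansions := by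
  refine hasCommonExpansions_of_link fun c d hcd => ?_
  have hu : (L.u (L.s c), L.u (L.s c)) ∈ L.mulDomain := (mul_u_of_eq (L.s_u _)).1
  exact (hL.connected_mulDomain_over (L.s c)).isPreconnected.induction₂' L.Link
    (fun p hp => hA.eventually_link hL.biRegular hp) (fun _ _ _ _ _ _ h h' => h.trans h')
    ⟨hcd, rfl, (mem_composable hcd).symm⟩ ⟨hu, L.s_u _, L.t_u _⟩

/-- A strongly connected, globally associative local Lie groupoid is generated by any arrows on
which the inversion is defined. -/
theorem StronglyConnected.exists_eqv_inversional (hL : L.StronglyConnected)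
    (hA : L.GloballyAssociative) (g : G) : ∃ w : List G, (∀ a ∈ w, a ∈ L.invDomain) ∧ L.Eqv [g] w := by
  set x := L.s g
  -- The last letter is moved along the connected source fiber from `g` to `u x`. Each small move,
  -- forwards or backwards, costs one letter of `invDomain` on its left.
  have key : ∃ C : List G, (∀ a ∈ C, a ∈ L.invDomain) ∧ L.Eqv [g] (C ++ [L.u x]) := by
    refine (hL.source_connected x).isPreconnected.induction₂'
      (fun g g' => ∃ C : List G, (∀ a ∈ C, a ∈ L.invDomain) ∧ L.Eqv [g] (C ++ [g']))
      (fun g hg => ?_) (fun g₁ g₂ g₃ _ _ _ h h' => ?_) (rfl : L.s g = x) (L.s_u x)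
    · obtain ⟨a, ha, ham⟩ := hL.biRegular.exists_small_left_factor g
      have l₁ : Filter.Tendsto (fun g' => g') (𝓝[L.s ⁻¹' {x}] g) (𝓝 g) := nhdsWithin_le_nhds
      have fa : ∀ᶠ g' in 𝓝[L.s ⁻¹' {x}] g, (a g', g) ∈ L.mulDomain ∧ L.mul (a g') g = g' := by
        filter_upwards [l₁.eventually ham, self_mem_nhdsWithin] with q h1 h2
        exact h1 (Eq.trans h2 hg.symm)
      have va : ∀ᶠ g' in 𝓝[L.s ⁻¹' {x}] g, a g' ∈ L.invDomain :=
        (ha.comp l₁).eventually (L.invDomain_open.mem_nhds (L.unit_mem_invDomain _))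
      have e₂ := (tendsto_mul (L.unit_mul_mem g) (tendsto_inv (ha.comp l₁)) l₁ (by
        filter_upwards [va, fa] with q h1 h2
        rw [Function.comp_apply, L.s_inv _ h1, ← h2.2, L.t_mul _ _ h2.1, h2.2])).1
      filter_upwards [fa, va, e₂] with g' h1 h2 h3
      refine ⟨⟨[L.inv (a g')], by simpa using L.inv_mem _ h2, ?_⟩, ⟨[a g'], by simpa using h2, ?_⟩⟩
      · have := hA.inv_mul_cancel h2 h1.1 (by rw [h1.2]; exact h3)
        rw [h1.2] at this
        have h4 := (Eqv.mul h3).symm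
        simp only [Function.comp_apply] at h4
        rwa [this] at h4
      · have := (Eqv.mul h1.1).symm
        rwa [h1.2] at this
    · obtain ⟨C, hC, hC'⟩ := h
      obtain ⟨D, hD, hD'⟩ := h'
      refine ⟨C ++ D, fun a ha => (List.mem_append.1 ha).elim (hC a) (hD a), ?_⟩
      rw [List.append_assoc]
      exact hC'.trans ((Eqv.refl C).append hD')
  obtain ⟨C, hC, hC'⟩ := key
  refine ⟨_, fun a ha => ?_, hC'⟩
  rcases List.mem_append.1 ha with h | h
  · exact hC a h
  · rw [List.mem_singleton.1 h]; exact L.unit_mem_invDomain x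

end Malcev

/-! ### Lifting smooth families of words along the congruence -/

section Lifting

variable {E : Type uE} [NormedAddCommGroup E] [NormedSpace ℝ E]
  {F : Type uF} [NormedAddCommGroup F] [NormedSpace ℝ F]
  {G : Type uG} [TopologicalSpace G] [ChartedSpace E G]
  {M : Type uM} [TopologicalSpace M] [ChartedSpace F M]
  {L : LocalLieGroupoid E F G M}
  {EP HP P : Type*} [NormedAddCommGroup EP] [NormedSpace ℝ EP]
  [TopologicalSpace HP] {I : ModelWithCorners ℝ EP HP} [TopologicalSpace P] [ChartedSpace HP P]

variable (I) in
/-- A family of words all of whose letters depend smoothly on the parameter near `p`. -/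
def SmoothWord (E : Type*) [NormedAddCommGroup E] [NormedSpace ℝ E] {G : Type*} [TopologicalSpace G]
    [ChartedSpace E G] (A : List (P → G)) (p : P) : Prop :=
  ∀ f ∈ A, SmoothNear I 𝓘(ℝ, E) f p

/-- The value of a family of words. -/
def wordAt {P G : Type*} (A : List (P → G)) (p : P) : List G := A.map fun f => f p

@[simp] theorem wordAt_nil {P G : Type*} (p : P) : wordAt ([] : List (P → G)) p = [] := rfl

@[simp] theorem wordAt_cons {P G : Type*} (f : P → G) (A : List (P → G)) (p : P) :
    wordAt (f :: A) p = f p :: wordAt A p := rfl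

@[simp] theorem wordAt_append {P G : Type*} (A B : List (P → G)) (p : P) :
    wordAt (A ++ B) p = wordAt A p ++ wordAt B p := List.map_append

theorem SmoothWord.append {A B : List (P → G)} {p : P} (hA : SmoothWord I E A p)
    (hB : SmoothWord I E B p) : SmoothWord I E (A ++ B) p :=
  fun f hf => (List.mem_append.1 hf).elim (hA f) (hB f)

variable (I L) in
/-- Smooth families of composable words that start at `a` can be lifted along a relation from `a`
to `b`. -/
def HasLifts (p : P) (a b : List G) : Prop :=
  ∀ A : List (P → G), SmoothWord I E A p → wordAt A p = a →
    (∀ᶠ q in 𝓝 p, ∃ y x, L.IsPath y (wordAt A q) x) →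
    ∃ B : List (P → G), SmoothWord I E B p ∧ wordAt B p = b ∧
      ∀ᶠ q in 𝓝 p, L.Eqv (wordAt A q) (wordAt B q)

theorem HasLifts.trans {p : P} {a b c : List G} (h : L.HasLifts I p a b)
    (h' : L.HasLifts I p b c) : L.HasLifts I p a c := by
  intro A hA hAa hAp
  obtain ⟨B, hB, hBb, hAB⟩ := h A hA hAa hAp
  obtain ⟨C, hC, hCc, hBC⟩ := h' B hB hBb (by
    filter_upwards [hAp, hAB] with q ⟨y, x, h1⟩ h2 using ⟨y, x, h2.isPath.1 h1⟩)
  refine ⟨C, hC, hCc, ?_⟩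
  filter_upwards [hAB, hBC] with q h1 h2 using h1.trans h2

theorem HasLifts.append {p : P} {a a' b b' : List G} (h : L.HasLifts I p a a')
    (h' : L.HasLifts I p b b') : L.HasLifts I p (a ++ b) (a' ++ b') := by
  intro A hA hAa hAp
  obtain ⟨A₁, A₂, rfl, h₁, h₂⟩ := List.map_eq_append_iff.1 hAa
  simp only [wordAt_append] at hAp
  obtain ⟨B₁, hB₁, hBb₁, hAB₁⟩ := h A₁ (fun f hf => hA f (by simp [hf])) h₁ (by
    filter_upwards [hAp] with q ⟨y, x, hq⟩
    obtain ⟨z, hz, -⟩ := isPath_append.1 hq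
    exact ⟨_, _, hz⟩)
  obtain ⟨B₂, hB₂, hBb₂, hAB₂⟩ := h' A₂ (fun f hf => hA f (by simp [hf])) h₂ (by
    filter_upwards [hAp] with q ⟨y, x, hq⟩
    obtain ⟨z, -, hz⟩ := isPath_append.1 hq
    exact ⟨_, _, hz⟩)
  refine ⟨B₁ ++ B₂, hB₁.append hB₂, by simp [hBb₁, hBb₂], ?_⟩
  filter_upwards [hAB₁, hAB₂] with q k₁ k₂
  simpa using k₁.append k₂

variable [IsManifold 𝓘(ℝ, E) ∞ G] [IsManifold 𝓘(ℝ, F) ∞ M]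

theorem exists_smooth_section {f : G → M} (hf : Manifold.IsSubmersion 𝓘(ℝ, E) 𝓘(ℝ, F) ∞ f)
    (g : G) : ∃ σ : M → G, SmoothNear 𝓘(ℝ, F) 𝓘(ℝ, E) σ (f g) ∧ σ (f g) = g ∧
      ∀ᶠ x in 𝓝 (f g), f (σ x) = x := by
  obtain ⟨K, _, _, hK⟩ := hf
  obtain ⟨κ, Θ, -, hΘ, hΘκ, -, h⟩ := exists_submersion_coordinates (hK g)
  have hin : SmoothNear 𝓘(ℝ, F) (𝓘(ℝ, F).prod 𝓘(ℝ, K)) (fun x => (x, κ g)) (f g) :=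
    (smoothNear_id _).prodMk (smoothNear_const _ _)
  refine ⟨fun x => Θ (x, κ g), hΘ.comp_of_eq hin rfl, hΘκ, ?_⟩
  filter_upwards [hin.mem_nhds rfl h] with x hx using hx.1

/-- The essential case is splitting a family `f` that starts at `g h`: the right factor is a local
section of `s` through `h`, evaluated at `s (f q)`, and smooth right division supplies the left
factor. -/
theorem Eqv.hasLifts [FiniteDimensional ℝ E] (hL : L.BiRegular) {a b : List G} (h : L.Eqv a b)
    (p : P) : L.HasLifts I p a b ∧ L.HasLifts I p b a := by
  induction h with
  | refl a =>
    have : L.HasLifts I p a a := fun A hA hAa _ => ⟨A, hA, hAa, .of_forall fun q => .refl _⟩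
    exact ⟨this, this⟩
  | symm _ ih => exact ih.symm
  | trans _ _ ih ih' => exact ⟨ih.1.trans ih'.1, ih'.2.trans ih.2⟩
  | append _ _ ih ih' => exact ⟨ih.1.append ih'.1, ih.2.append ih'.2⟩
  | @mul g h hgh =>
    constructor
    · intro A hA hAa hAp
      obtain ⟨f, A, rfl, hf, hA'⟩ := List.map_eq_cons_iff.1 hAa
      obtain ⟨f', A, rfl, hf', hA''⟩ := List.map_eq_cons_iff.1 hA'
      obtain rfl := List.map_eq_nil_iff.1 hA''
      obtain ⟨h₁, h₂⟩ := L.partialMul.smoothNear_mul (hA f (by simp)) (hA f' (by simp))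
        (by rw [hf, hf']; exact hgh)
        (by filter_upwards [hAp] with q ⟨y, x, hq⟩ using hq.2.1.symm)
      refine ⟨[fun q => L.mul (f q) (f' q)], by simpa [SmoothWord] using h₁, by simp [hf, hf'], ?_⟩
      filter_upwards [h₂] with q hq using .mul hq
    · intro A hA hAa hAp
      obtain ⟨f, A, rfl, hf, hA'⟩ := List.map_eq_cons_iff.1 hAa
      obtain rfl := List.map_eq_nil_iff.1 hA'
      have hfs : SmoothNear I 𝓘(ℝ, E) f p := hA f (by simp)
      obtain ⟨D, hD, hDs, hDm⟩ := hL.exists_right_division hgh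
      obtain ⟨σ, hσ, hσh, hsσ⟩ := exists_smooth_section L.isSubmersion_s h
      have hsf : L.s (f p) = L.s h := by rw [hf, L.s_mul _ _ hgh]
      have hsfs : SmoothNear I 𝓘(ℝ, F) (fun q => L.s (f q)) p := (L.smoothNear_s _).comp hfs
      have h₁ : SmoothNear I 𝓘(ℝ, E) (fun q => σ (L.s (f q))) p := hσ.comp_of_eq hsfs hsf
      have h₂ := hfs.prodMk h₁
      have h₃ : (f p, σ (L.s (f p))) = (L.mul g h, h) := by rw [hsf, hσh, hf]
      refine ⟨[fun q => D (f q, σ (L.s (f q))), fun q => σ (L.s (f q))], ?_, ?_, ?_⟩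
      · intro k hk
        rcases List.mem_cons.1 hk with rfl | hk
        · exact hDs.comp_of_eq h₂ h₃
        · rw [List.mem_singleton.1 hk]; exact h₁
      · have h₄ : D (f p, σ (L.s (f p))) = g := by rw [h₃, hD]
        rw [wordAt_cons, h₄, wordAt_cons, hsf, hσh, wordAt_nil]
      · filter_upwards [h₂.mem_nhds h₃ hDm, hsfs.mem_nhds hsf hsσ] with q k₁ k₂
        obtain ⟨k₃, k₄⟩ := k₁ k₂.symm
        have := (Eqv.mul k₃).symm
        rw [k₄] at this
        exact this

/-- Move the first letter by a local section of the target map, and move the remaining word by the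
section that the induction gives at the source of that letter. -/
theorem exists_smoothWord_section {w : List G} {y x : M} (h : L.IsPath y w x) :
    ∃ A : List (M → G), SmoothWord 𝓘(ℝ, F) E A y ∧ wordAt A y = w ∧
      ∀ᶠ z in 𝓝 y, ∃ x, L.IsPath z (wordAt A z) x := by
  induction w generalizing y with
  | nil => exact ⟨[], fun f hf => absurd hf (by simp), rfl, .of_forall fun z => ⟨z, rfl⟩⟩
  | cons g w ih =>
    obtain ⟨rfl, h⟩ := h
    obtain ⟨A, hA, hAw, hAp⟩ := ih h
    obtain ⟨σ, hσ, hσg, htσ⟩ := exists_smooth_section L.isSubmersion_t g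
    have hs : SmoothNear 𝓘(ℝ, F) 𝓘(ℝ, F) (fun z => L.s (σ z)) (L.t g) :=
      (L.smoothNear_s _).comp hσ
    have hs0 : L.s (σ (L.t g)) = L.s g := by rw [hσg]
    refine ⟨σ :: A.map fun f z => f (L.s (σ z)), ?_, ?_, ?_⟩
    · intro k hk
      rcases List.mem_cons.1 hk with rfl | hk
      · exact hσ
      · obtain ⟨f, hf, rfl⟩ := List.mem_map.1 hk
        exact (hA f hf).comp_of_eq hs hs0
    · simp only [wordAt_cons, hσg, List.cons.injEq, true_and]
      rw [← hAw, wordAt, List.map_map]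
      simp [Function.comp_def, hσg, wordAt]
    · filter_upwards [htσ, hs.mem_nhds hs0 hAp] with z h₁ ⟨x, h₂⟩
      refine ⟨x, h₁, ?_⟩
      simpa [wordAt, Function.comp_def] using h₂

end Lifting

/-! ### The associative completion as an algebraic groupoid -/

section Completion

variable {E : Type uE} [NormedAddCommGroup E] [NormedSpace ℝ E]
  {F : Type uF} [NormedAddCommGroup F] [NormedSpace ℝ F]
  {G : Type uG} [TopologicalSpace G] [ChartedSpace E G]
  {M : Type uM} [TopologicalSpace M] [ChartedSpace F M]
  {L : LocalLieGroupoid E F G M}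

/-- Nonempty composable words, up to the congruence generated by the multiplication. -/
def wordSetoid (L : LocalLieGroupoid E F G M) :
    Setoid {w : List G // w ≠ [] ∧ ∃ y x, L.IsPath y w x} where
  r a b := L.Eqv a.1 b.1
  iseqv := ⟨fun _ => .refl _, fun h => h.symm, fun h h' => h.trans h'⟩

/-- The associative completion of a local Lie groupoid. -/
def Completion (_ : L.StronglyConnected) (_ : L.GloballyAssociative) : Type uG :=
  Quotient L.wordSetoid

namespace Completion

variable {hL : L.StronglyConnected} {hA : L.GloballyAssociative}

/-- The word `w` represents the arrow `p` of the completion. -/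
def Rep (w : List G) (p : Completion hL hA) : Prop :=
  ∃ h, Quotient.mk L.wordSetoid ⟨w, h⟩ = p

theorem exists_rep (p : Completion hL hA) : ∃ w, Rep w p := by
  induction p using Quotient.inductionOn with
  | h a => exact ⟨a.1, a.2, rfl⟩

theorem exists_of_isPath {w : List G} (hw : w ≠ []) {y x : M} (h : L.IsPath y w x) :
    ∃ p : Completion hL hA, Rep w p := ⟨_, ⟨hw, y, x, h⟩, rfl⟩

theorem Rep.unique {w : List G} {p q : Completion hL hA} (h : Rep w p) (h' : Rep w q) : p = q := by
  obtain ⟨_, rfl⟩ := h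
  obtain ⟨_, rfl⟩ := h'
  rfl

theorem Rep.eqv {w w' : List G} {p : Completion hL hA} (h : Rep w p) (h' : Rep w' p) :
    L.Eqv w w' := by
  obtain ⟨_, rfl⟩ := h
  obtain ⟨_, h'⟩ := h'
  exact (Quotient.exact h').symm

theorem Rep.of_eqv {w w' : List G} {p : Completion hL hA} (h : Rep w p) (h' : L.Eqv w w') :
    Rep w' p := by
  obtain ⟨⟨h₁, y, x, h₂⟩, rfl⟩ := h
  exact ⟨⟨h'.ne_nil.1 h₁, y, x, h'.isPath.1 h₂⟩, (Quotient.sound h').symm⟩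

theorem Rep.ne_nil {w : List G} {p : Completion hL hA} (h : Rep w p) : w ≠ [] := h.1.1

theorem exists_ends (p : Completion hL hA) : ∃ e : M × M, ∀ w, Rep w p → L.IsPath e.1 w e.2 := by
  obtain ⟨w, hw⟩ := exists_rep p
  obtain ⟨⟨h₁, y, x, h₂⟩, h₃⟩ := id hw
  exact ⟨(y, x), fun w' hw' => (hw.eqv hw').isPath.1 h₂⟩

/-- The target map of the completion. -/
noncomputable def tgt (p : Completion hL hA) : M := (exists_ends p).choose.1

/-- The source map of the completion. -/
noncomputable def src (p : Completion hL hA) : M := (exists_ends p).choose.2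

theorem Rep.isPath {w : List G} {p : Completion hL hA} (h : Rep w p) :
    L.IsPath (tgt p) w (src p) := (exists_ends p).choose_spec w h

theorem Rep.ends {w : List G} {p : Completion hL hA} (h : Rep w p) {y x : M}
    (h' : L.IsPath y w x) : tgt p = y ∧ src p = x := h.isPath.unique h.ne_nil h'

theorem exists_mul (p q : Completion hL hA) : ∃ r : Completion hL hA,
    src p = tgt q → ∀ a b, Rep a p → Rep b q → Rep (a ++ b) r := by
  by_cases h : src p = tgt q
  · obtain ⟨a, ha⟩ := exists_rep p
    obtain ⟨b, hb⟩ := exists_rep q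
    obtain ⟨r, hr⟩ := exists_of_isPath (hL := hL) (hA := hA) (w := a ++ b) (by simp [ha.ne_nil])
      (isPath_append.2 ⟨_, ha.isPath, h ▸ hb.isPath⟩)
    exact ⟨r, fun _ a' b' ha' hb' => hr.of_eqv ((ha.eqv ha').append (hb.eqv hb'))⟩
  -- Default value for pairs that are not composable.
  · exact ⟨p, fun h' => absurd h' h⟩

/-- The multiplication of the completion. -/
noncomputable def mul (p q : Completion hL hA) : Completion hL hA := (exists_mul p q).choose

theorem Rep.mul {a b : List G} {p q : Completion hL hA} (ha : Rep a p) (hb : Rep b q)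
    (h : src p = tgt q) : Rep (a ++ b) (mul p q) := (exists_mul p q).choose_spec h a b ha hb

theorem exists_ofArrow (g : G) : ∃ p : Completion hL hA, Rep [g] p :=
  exists_of_isPath (y := L.t g) (x := L.s g) (by simp) (by simp)

variable (hL hA) in
/-- The map from a local Lie groupoid to its completion. -/
noncomputable def ofArrow (g : G) : Completion hL hA := (exists_ofArrow g).choose

theorem rep_ofArrow (g : G) : Rep [g] (ofArrow hL hA g) := (exists_ofArrow g).choose_spec

theorem tgt_ofArrow (g : G) : tgt (ofArrow hL hA g) = L.t g :=
  ((rep_ofArrow g).ends (y := L.t g) (x := L.s g) (by simp)).1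

theorem src_ofArrow (g : G) : src (ofArrow hL hA g) = L.s g :=
  ((rep_ofArrow g).ends (y := L.t g) (x := L.s g) (by simp)).2

theorem tgt_mul {p q : Completion hL hA} (h : src p = tgt q) : tgt (mul p q) = tgt p := by
  obtain ⟨a, ha⟩ := exists_rep p
  obtain ⟨b, hb⟩ := exists_rep q
  exact ((ha.mul hb h).ends (isPath_append.2 ⟨_, ha.isPath, h ▸ hb.isPath⟩)).1

theorem src_mul {p q : Completion hL hA} (h : src p = tgt q) : src (mul p q) = src q := by
  obtain ⟨a, ha⟩ := exists_rep p
  obtain ⟨b, hb⟩ := exists_rep q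
  exact ((ha.mul hb h).ends (isPath_append.2 ⟨_, ha.isPath, h ▸ hb.isPath⟩)).2

theorem mul_assoc {p q r : Completion hL hA} (h : src p = tgt q) (h' : src q = tgt r) :
    mul (mul p q) r = mul p (mul q r) := by
  obtain ⟨a, ha⟩ := exists_rep p
  obtain ⟨b, hb⟩ := exists_rep q
  obtain ⟨c, hc⟩ := exists_rep r
  have h₁ := (ha.mul hb h).mul hc ((src_mul h).trans h')
  have h₂ := ha.mul (hb.mul hc h') (h.trans (tgt_mul h').symm)
  rw [List.append_assoc] at h₁
  exact h₁.unique h₂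

theorem ofArrow_mul {g h : G} (hgh : (g, h) ∈ L.mulDomain) :
    mul (ofArrow hL hA g) (ofArrow hL hA h) = ofArrow hL hA (L.mul g h) := by
  have := (rep_ofArrow (hL := hL) (hA := hA) g).mul (rep_ofArrow h)
    (by rw [src_ofArrow, tgt_ofArrow, mem_composable hgh])
  exact (this.of_eqv (.mul hgh)).unique (rep_ofArrow _)

variable (hL hA) in
/-- The unit map of the completion. -/
noncomputable def unit (x : M) : Completion hL hA := ofArrow hL hA (L.u x)

theorem rep_unit (x : M) : Rep [L.u x] (unit hL hA x) := rep_ofArrow _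

theorem tgt_unit (x : M) : tgt (unit hL hA x) = x := by rw [unit, tgt_ofArrow, L.t_u]

theorem src_unit (x : M) : src (unit hL hA x) = x := by rw [unit, src_ofArrow, L.s_u]

theorem eqv_unit_cons {w : List G} (hw : w ≠ []) {y x : M} (h : L.IsPath y w x) :
    L.Eqv (L.u y :: w) w := by
  cases w with
  | nil => exact absurd rfl hw
  | cons g w =>
    obtain ⟨rfl, h⟩ := h
    have := (Eqv.mul (L.unit_mul_mem g)).append (Eqv.refl w)
    rwa [L.unit_mul] at this

theorem eqv_append_unit {w : List G} (hw : w ≠ []) {y x : M} (h : L.IsPath y w x) :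
    L.Eqv (w ++ [L.u x]) w := by
  induction w generalizing y with
  | nil => exact absurd rfl hw
  | cons g w ih =>
    obtain ⟨rfl, h⟩ := h
    cases w with
    | nil =>
      have := Eqv.mul (L.mul_unit_mem g)
      rw [L.mul_unit] at this
      rw [isPath_nil] at h
      rwa [← h]
    | cons k w => exact (Eqv.refl [g]).append (ih (by simp) h)

theorem unit_mul (p : Completion hL hA) : mul (unit hL hA (tgt p)) p = p := by
  obtain ⟨a, ha⟩ := exists_rep p
  exact (((rep_unit _).mul ha (src_unit _)).of_eqv (eqv_unit_cons ha.ne_nil ha.isPath)).unique ha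

theorem mul_unit (p : Completion hL hA) : mul p (unit hL hA (src p)) = p := by
  obtain ⟨a, ha⟩ := exists_rep p
  exact ((ha.mul (rep_unit _) (tgt_unit _).symm).of_eqv
    (eqv_append_unit ha.ne_nil ha.isPath)).unique ha

/-- The formal inverse of a word. -/
def invWord (L : LocalLieGroupoid E F G M) (w : List G) : List G := (w.map L.inv).reverse

theorem isPath_invWord {w : List G} (hw : ∀ a ∈ w, a ∈ L.invDomain) {y x : M}
    (h : L.IsPath y w x) : L.IsPath x (invWord L w) y := by
  induction w generalizing y with
  | nil => exact h.symm
  | cons a w ih =>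
    obtain ⟨rfl, h⟩ := h
    simp only [invWord, List.map_cons, List.reverse_cons, isPath_append]
    exact ⟨_, ih (fun b hb => hw b (by simp [hb])) h, L.t_inv a (hw a (by simp)),
      L.s_inv a (hw a (by simp))⟩

/-- The leading unit makes the empty word a valid start of the induction. In the step it passes the
first letter, `u (t a) a ~ a ~ a u (s a)`, and so stands in front of the remaining word. -/
theorem eqv_word_invWord {w : List G} (hw : ∀ a ∈ w, a ∈ L.invDomain) {y x : M}
    (h : L.IsPath y w x) : L.Eqv ([L.u y] ++ (w ++ invWord L w)) [L.u y] := by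
  induction w generalizing y with
  | nil => exact .refl _
  | cons a w ih =>
    obtain ⟨rfl, h⟩ := h
    have ha := hw a (by simp)
    have ih := ih (fun b hb => hw b (by simp [hb])) h
    have h₁ : L.Eqv ([L.u (L.t a)] ++ [a]) ([a] ++ [L.u (L.s a)]) := by
      have h1 := Eqv.mul (L.unit_mul_mem a)
      have h2 := Eqv.mul (L.mul_unit_mem a)
      rw [L.unit_mul] at h1
      rw [L.mul_unit] at h2
      exact h1.trans h2.symm
    have h₂ : L.Eqv ([a] ++ ([L.u (L.s a)] ++ (w ++ invWord L w)) ++ [L.inv a])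
        ([a] ++ [L.u (L.s a)] ++ [L.inv a]) := ((Eqv.refl _).append ih).append (.refl _)
    have h₃ : L.Eqv ([a] ++ [L.u (L.s a)] ++ [L.inv a]) [L.u (L.t a)] := by
      have h1 := Eqv.mul (L.mul_unit_mem a)
      rw [L.mul_unit] at h1
      have h2 := Eqv.mul (mul_inv_mem ha)
      rw [L.mul_inv a ha] at h2
      exact (h1.append (.refl [L.inv a])).trans h2
    have h₄ := h₁.append (Eqv.refl (w ++ invWord L w ++ [L.inv a]))
    have := h₄.trans (by simpa using h₂.trans h₃)
    simpa [invWord] using this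

theorem eqv_invWord_word {w : List G} (hw : ∀ a ∈ w, a ∈ L.invDomain) {y x : M}
    (h : L.IsPath y w x) : L.Eqv ([L.u x] ++ invWord L w ++ [L.u y] ++ w) [L.u x] := by
  induction w generalizing y with
  | nil =>
    rw [isPath_nil] at h
    subst h
    have := eqv_unit_cons (L := L) (w := [L.u y]) (by simp) (y := y) (x := y)
      (by simp [L.t_u, L.s_u])
    simpa [invWord] using this
  | cons a w ih =>
    obtain ⟨rfl, h⟩ := h
    have ha := hw a (by simp)
    have ih := ih (fun b hb => hw b (by simp [hb])) h
    have h₁ : L.Eqv ([L.inv a] ++ ([L.u (L.t a)] ++ [a])) [L.u (L.s a)] := by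
      have h1 := Eqv.mul (L.unit_mul_mem a)
      rw [L.unit_mul] at h1
      have h2 := Eqv.mul (inv_mul_mem ha)
      rw [L.inv_mul a ha] at h2
      exact ((Eqv.refl [L.inv a]).append h1).trans h2
    have h₂ := ((Eqv.refl ([L.u x] ++ invWord L w)).append h₁).append (.refl w)
    have := h₂.trans ih
    simpa [invWord] using this

/-- Products of `n + 1` arrows of the local Lie groupoid. -/
def products (hL : L.StronglyConnected) (hA : L.GloballyAssociative) :
    ℕ → Set (Completion hL hA)
  | 0 => Set.range (ofArrow hL hA)
  | n + 1 => {p | ∃ g, ∃ q ∈ products hL hA n, L.s g = tgt q ∧ p = mul (ofArrow hL hA g) q}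

theorem exists_mem_products (p : Completion hL hA) : ∃ n, p ∈ products hL hA n := by
  obtain ⟨w, hw⟩ := exists_rep p
  induction w generalizing p with
  | nil => exact absurd rfl hw.ne_nil
  | cons g w ih =>
    by_cases hne : w = []
    · subst hne
      exact ⟨0, g, (rep_ofArrow g).unique hw⟩
    · obtain ⟨q, hq⟩ := exists_of_isPath (hL := hL) (hA := hA) hne hw.isPath.2
      obtain ⟨n, hn⟩ := ih q hq
      have ht := (hq.ends hw.isPath.2).1
      have hc : src (ofArrow hL hA g) = tgt q := by rw [src_ofArrow, ht]
      exact ⟨n + 1, g, q, hn, ht.symm, hw.unique ((rep_ofArrow g).mul hq hc)⟩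

variable [FiniteDimensional ℝ E] [IsManifold 𝓘(ℝ, E) ∞ G] [IsManifold 𝓘(ℝ, F) ∞ M]

theorem exists_inversional_eqv (hL : L.StronglyConnected) (hA : L.GloballyAssociative)
    (w : List G) : ∃ v : List G, (∀ a ∈ v, a ∈ L.invDomain) ∧ L.Eqv w v := by
  induction w with
  | nil => exact ⟨[], by simp, .refl _⟩
  | cons g w ih =>
    obtain ⟨v, hv, hwv⟩ := ih
    obtain ⟨c, hc, hgc⟩ := hL.exists_eqv_inversional hA g
    exact ⟨c ++ v, fun a ha => (List.mem_append.1 ha).elim (hc a) (hv a), hgc.append hwv⟩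

/-- Every class contains a word with letters in `invDomain`; the reversed word of inverses
represents the inverse. -/
theorem exists_inv (p : Completion hL hA) : ∃ q : Completion hL hA, tgt q = src p ∧
    src q = tgt p ∧ mul q p = unit hL hA (src p) ∧ mul p q = unit hL hA (tgt p) ∧
    ∃ w, (∀ a ∈ w, a ∈ L.invDomain) ∧ Rep w p ∧ Rep (invWord L w) q := by
  obtain ⟨w', hw'⟩ := exists_rep p
  obtain ⟨w, hw, hww⟩ := exists_inversional_eqv hL hA w'
  have hp := hw'.of_eqv hww
  have hi := isPath_invWord hw hp.isPath
  have hne : invWord L w ≠ [] := by simpa [invWord] using hp.ne_nil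
  obtain ⟨q, hq⟩ := exists_of_isPath (hL := hL) (hA := hA) hne hi
  have he := hq.ends hi
  refine ⟨q, he.1, he.2, ?_, ?_, w, hw, hp, hq⟩
  · refine ((hq.mul hp he.2).of_eqv ?_).unique (rep_unit _)
    have h₁ := eqv_invWord_word hw hp.isPath
    have h₂ := (eqv_unit_cons hne hi).append (eqv_unit_cons hp.ne_nil hp.isPath)
    exact h₂.symm.trans (by simpa using h₁)
  · refine ((hp.mul hq he.1.symm).of_eqv ?_).unique (rep_unit _)
    have h₁ := eqv_word_invWord hw hp.isPath
    have h₂ := eqv_unit_cons (L := L) (w := w ++ invWord L w) (by simp [hne])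
      (isPath_append.2 ⟨_, hp.isPath, hi⟩)
    exact h₂.symm.trans h₁

/-- The inversion of the completion. -/
noncomputable def inv (p : Completion hL hA) : Completion hL hA := (exists_inv p).choose

theorem tgt_inv (p : Completion hL hA) : tgt (inv p) = src p := (exists_inv p).choose_spec.1

theorem src_inv (p : Completion hL hA) : src (inv p) = tgt p := (exists_inv p).choose_spec.2.1

theorem inv_mul (p : Completion hL hA) : mul (inv p) p = unit hL hA (src p) :=
  (exists_inv p).choose_spec.2.2.1

theorem mul_inv (p : Completion hL hA) : mul p (inv p) = unit hL hA (tgt p) :=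
  (exists_inv p).choose_spec.2.2.2.1

theorem inv_mul_cancel {p q : Completion hL hA} (h : src p = tgt q) :
    mul (inv p) (mul p q) = q := by
  rw [← mul_assoc (src_inv p) h, inv_mul, h, unit_mul]

theorem mul_inv_cancel_left {p q : Completion hL hA} (h : tgt p = tgt q) :
    mul p (mul (inv p) q) = q := by
  rw [← mul_assoc (tgt_inv p).symm ((src_inv p).trans h), mul_inv, h, unit_mul]

theorem eq_inv_of_mul_eq_unit {p q : Completion hL hA} (h : src p = tgt q)
    (h' : mul p q = unit hL hA (tgt p)) : q = inv p := by
  have h₁ := inv_mul_cancel h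
  rw [h', ← src_inv p, mul_unit] at h₁
  exact h₁.symm

theorem inv_inv (p : Completion hL hA) : inv (inv p) = p := by
  refine (eq_inv_of_mul_eq_unit (src_inv p) ?_).symm
  rw [inv_mul, tgt_inv]

theorem ofArrow_inv {g : G} (hg : g ∈ L.invDomain) :
    ofArrow hL hA (L.inv g) = inv (ofArrow hL hA g) := by
  refine eq_inv_of_mul_eq_unit ?_ ?_
  · rw [src_ofArrow, tgt_ofArrow, L.t_inv g hg]
  · rw [ofArrow_mul (mul_inv_mem hg), L.mul_inv g hg, tgt_ofArrow]
    rfl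

theorem Rep.inv {w : List G} {p : Completion hL hA} (hp : Rep w p)
    (hw : ∀ a ∈ w, a ∈ L.invDomain) : Rep (invWord L w) (inv p) := by
  have hi := isPath_invWord hw hp.isPath
  have hne : invWord L w ≠ [] := by simpa [invWord] using hp.ne_nil
  obtain ⟨q, hq⟩ := exists_of_isPath (hL := hL) (hA := hA) hne hi
  have he := hq.ends hi
  have : q = Completion.inv p := by
    refine eq_inv_of_mul_eq_unit he.1.symm (((hp.mul hq he.1.symm).of_eqv ?_).unique (rep_unit _))
    have h₁ := eqv_word_invWord hw hp.isPath
    have h₂ := eqv_unit_cons (L := L) (w := w ++ invWord L w) (by simp [hne])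
      (isPath_append.2 ⟨_, hp.isPath, hi⟩)
    exact h₂.symm.trans h₁
  rwa [← this]

/-- The Mal'cev step: a common expansion of two congruent letters is a single word with both letters
as values, which global associativity forces to agree. -/
theorem ofArrow_injective : Function.Injective (ofArrow hL hA) := fun _ h e =>
  (hL.hasCommonExpansions hA).eq_of_eqv hA ((rep_ofArrow _).eqv (e ▸ rep_ofArrow h))

end Completion

end Completion

namespace Completion

/-! ### Plots: maps to the completion given by smooth families of words -/

section Plots

variable {E : Type uE} [NormedAddCommGroup E] [NormedSpace ℝ E]
  {F : Type uF} [NormedAddCommGroup F] [NormedSpace ℝ F]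
  {G : Type uG} [TopologicalSpace G] [ChartedSpace E G]
  {M : Type uM} [TopologicalSpace M] [ChartedSpace F M]
  {L : LocalLieGroupoid E F G M} {hL : L.StronglyConnected} {hA : L.GloballyAssociative}
  {EP HP P : Type*} [NormedAddCommGroup EP] [NormedSpace ℝ EP]
  [TopologicalSpace HP] {I : ModelWithCorners ℝ EP HP} [TopologicalSpace P] [ChartedSpace HP P]
  {EQ HQ Q : Type*} [NormedAddCommGroup EQ] [NormedSpace ℝ EQ]
  [TopologicalSpace HQ] {J : ModelWithCorners ℝ EQ HQ} [TopologicalSpace Q] [ChartedSpace HQ Q]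

variable (I) in
/-- The map `f` to the completion is represented by a smooth family of words near `p`. -/
def Plot (f : P → Completion hL hA) (p : P) : Prop :=
  ∃ A : List (P → G), SmoothWord I E A p ∧ ∀ᶠ q in 𝓝 p, Rep (wordAt A q) (f q)

theorem Plot.eventually {f : P → Completion hL hA} {p : P} (h : Plot I f p) :
    ∀ᶠ q in 𝓝 p, Plot I f q := by
  obtain ⟨A, hA, hf⟩ := h
  have h₁ : ∀ᶠ q in 𝓝 p, SmoothWord I E A q :=
    (Filter.eventually_all_finite A.finite_toSet).2 fun k hk => (hA k hk).eventually
  filter_upwards [h₁, hf.eventually_nhds] with q hq hq' using ⟨A, hq, hq'⟩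

theorem Plot.congr {f g : P → Completion hL hA} {p : P} (h : Plot I f p) (h' : f =ᶠ[𝓝 p] g) :
    Plot I g p := by
  obtain ⟨A, hA, hf⟩ := h
  refine ⟨A, hA, ?_⟩
  filter_upwards [hf, h'] with q h₁ h₂
  rwa [← h₂]

theorem Plot.comp_of_eq {f : Q → Completion hL hA} {φ : P → Q} {p : P} {q : Q} (h : Plot J f q)
    (hφ : SmoothNear I J φ p) (hq : φ p = q) : Plot I (fun x => f (φ x)) p := by
  obtain ⟨A, hA, hf⟩ := h
  refine ⟨A.map fun k x => k (φ x), fun k hk => ?_, ?_⟩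
  · obtain ⟨k, hk', rfl⟩ := List.mem_map.1 hk
    exact (hA k hk').comp_of_eq hφ hq
  · filter_upwards [hφ.mem_nhds hq hf] with x hx
    simpa [wordAt, Function.comp_def] using hx

theorem Plot.mul {f g : P → Completion hL hA} {p : P} (hf : Plot I f p) (hg : Plot I g p)
    (h : ∀ᶠ q in 𝓝 p, src (f q) = tgt (g q)) : Plot I (fun q => mul (f q) (g q)) p := by
  obtain ⟨A, hA, hf⟩ := hf
  obtain ⟨B, hB, hg⟩ := hg
  refine ⟨A ++ B, hA.append hB, ?_⟩
  filter_upwards [hf, hg, h] with q h₁ h₂ h₃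
  simpa using h₁.mul h₂ h₃

theorem plot_ofArrow {f : P → G} {p : P} (hf : SmoothNear I 𝓘(ℝ, E) f p) :
    Plot I (fun q => ofArrow hL hA (f q)) p :=
  ⟨[f], by simpa [SmoothWord] using hf, .of_forall fun q => rep_ofArrow _⟩

theorem Plot.smoothNear_tgt {f : P → Completion hL hA} {p : P} (hf : Plot I f p) :
    SmoothNear I 𝓘(ℝ, F) (fun q => tgt (f q)) p := by
  obtain ⟨A, hA, hf⟩ := hf
  cases A with
  | nil => exact absurd rfl hf.self_of_nhds.ne_nil
  | cons a A =>
    refine ((L.smoothNear_t _).comp (hA a (by simp))).congr ?_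
    filter_upwards [hf] with q hq using hq.isPath.1

variable [IsManifold 𝓘(ℝ, E) ∞ G] [IsManifold 𝓘(ℝ, F) ∞ M]

theorem exists_plot_section (p : Completion hL hA) : ∃ τ : M → Completion hL hA,
    Plot 𝓘(ℝ, F) τ (tgt p) ∧ τ (tgt p) = p ∧ ∀ᶠ x in 𝓝 (tgt p), tgt (τ x) = x := by
  obtain ⟨w, hw⟩ := exists_rep p
  obtain ⟨A, hAs, hAw, h⟩ := exists_smoothWord_section hw.isPath
  have hne : ∀ z, wordAt A z ≠ [] := by
    intro z hz
    have := List.map_eq_nil_iff.1 hz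
    subst this
    exact hw.ne_nil hAw.symm
  have hr : ∀ z, ∃ q : Completion hL hA, ∀ x, L.IsPath z (wordAt A z) x → Rep (wordAt A z) q := by
    intro z
    by_cases hz : ∃ x, L.IsPath z (wordAt A z) x
    · obtain ⟨x, hx⟩ := hz
      obtain ⟨q, hq⟩ := exists_of_isPath (hne z) hx
      exact ⟨q, fun _ _ => hq⟩
    -- Default value where the word of sections is not composable; this does not occur near `tgt p`.
    · exact ⟨p, fun x hx => absurd ⟨x, hx⟩ hz⟩
  choose τ hτ using hr
  refine ⟨τ, ⟨A, hAs, ?_⟩, ?_, ?_⟩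
  · filter_upwards [h] with z ⟨x, hx⟩ using hτ z x hx
  · have := hτ (tgt p) (src p) (by rw [hAw]; exact hw.isPath)
    rw [hAw] at this
    exact this.unique hw
  · filter_upwards [h] with z ⟨x, hx⟩ using ((hτ z x hx).ends hx).1

variable [FiniteDimensional ℝ E]

/-- The family defining the plot starts at some word for `f p`; lifting along the congruence moves
its start to `w`. -/
theorem Plot.exists_lift {f : P → Completion hL hA} {p : P} (hf : Plot I f p) {w : List G}
    (hw : Rep w (f p)) : ∃ A : List (P → G), SmoothWord I E A p ∧ wordAt A p = w ∧
      ∀ᶠ q in 𝓝 p, Rep (wordAt A q) (f q) := by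
  obtain ⟨A, hA, hf⟩ := hf
  obtain ⟨B, hB, hBw, h⟩ := ((hf.self_of_nhds.eqv hw).hasLifts (I := I) hL.biRegular p).1 A hA rfl
    (by filter_upwards [hf] with q hq using ⟨_, _, hq.isPath⟩)
  refine ⟨B, hB, hBw, ?_⟩
  filter_upwards [hf, h] with q h₁ h₂ using h₁.of_eqv h₂

/-- Lifting to a word of length one turns the plot into a smooth map to `G`. This also yields the
openness of the image of `G` and local inverses of `ofArrow`. -/
theorem Plot.exists_lift_arrow {f : P → Completion hL hA} {p : P} (hf : Plot I f p) {g : G}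
    (hg : f p = ofArrow hL hA g) : ∃ c : P → G, SmoothNear I 𝓘(ℝ, E) c p ∧ c p = g ∧
      ∀ᶠ q in 𝓝 p, f q = ofArrow hL hA (c q) := by
  obtain ⟨A, hAs, hAg, h⟩ := hf.exists_lift (w := [g]) (hg ▸ rep_ofArrow g)
  obtain ⟨c, A, rfl, hc, hA'⟩ := List.map_eq_cons_iff.1 hAg
  obtain rfl := List.map_eq_nil_iff.1 hA'
  refine ⟨c, hAs c (by simp), hc, ?_⟩
  filter_upwards [h] with q hq using hq.unique (rep_ofArrow _)

/-- The family is first lifted to start at a word with letters in `invDomain`; these letters stay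
there nearby and can be inverted one by one. -/
theorem Plot.inv {f : P → Completion hL hA} {p : P} (hf : Plot I f p) :
    Plot I (fun q => Completion.inv (f q)) p := by
  obtain ⟨w', hw'⟩ := exists_rep (f p)
  obtain ⟨w, hw, hww⟩ := exists_inversional_eqv hL hA w'
  obtain ⟨A, hAs, hAw, h⟩ := hf.exists_lift (hw'.of_eqv hww)
  have hmem : ∀ k ∈ A, k p ∈ L.invDomain := fun k hk =>
    hw _ (hAw ▸ List.mem_map.2 ⟨k, hk, rfl⟩)
  have hev : ∀ᶠ q in 𝓝 p, ∀ k ∈ A, k q ∈ L.invDomain :=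
    (Filter.eventually_all_finite A.finite_toSet).2 fun k hk =>
      (hAs k hk).continuousAt.eventually (L.invDomain_open.mem_nhds (hmem k hk))
  refine ⟨(A.map fun k q => L.inv (k q)).reverse, fun k hk => ?_, ?_⟩
  · obtain ⟨k, hk', rfl⟩ := List.mem_map.1 (List.mem_reverse.1 hk)
    exact (L.contMDiffOn_inv.smoothNear (L.invDomain_open.mem_nhds (hmem k hk'))).comp (hAs k hk')
  · filter_upwards [h, hev] with q h₁ h₂
    have := h₁.inv (by simpa [wordAt] using h₂)
    simpa [invWord, wordAt, Function.comp_def] using this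

theorem Plot.smoothNear_src {f : P → Completion hL hA} {p : P} (hf : Plot I f p) :
    SmoothNear I 𝓘(ℝ, F) (fun q => src (f q)) p := by
  simpa [tgt_inv] using hf.inv.smoothNear_tgt

end Plots

/-! ### Charts of the completion -/

section Charts

variable {E : Type uE} [NormedAddCommGroup E] [NormedSpace ℝ E]
  {F : Type uF} [NormedAddCommGroup F] [NormedSpace ℝ F]
  {G : Type uG} [TopologicalSpace G] [ChartedSpace E G]
  {M : Type uM} [TopologicalSpace M] [ChartedSpace F M]
  {L : LocalLieGroupoid E F G M} {hL : L.StronglyConnected} {hA : L.GloballyAssociative}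

variable (hL hA) in
/-- The data for a chart of the completion: an arrow `p` with target `x` is written as the product
of `τ x`, for a local section `τ` of the target map, and of a small arrow, in adapted coordinates
for the target map. -/
structure ChartData (K : Type*) [NormedAddCommGroup K] [NormedSpace ℝ K] where
  /-- the chart of the unit manifold -/
  ψ : OpenPartialHomeomorph M F
  mem_maximalAtlas : ψ ∈ IsManifold.maximalAtlas 𝓘(ℝ, F) ∞ M
  /-- the splitting of the model space -/
  e : E ≃L[ℝ] F × K
  /-- the section of the target map -/
  τ : M → Completion hL hA
  /-- the coordinate along the target fibers -/
  κ : G → K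
  /-- the parametrization of arrows by target and fiber coordinate -/
  Θ : M × K → G
  /-- the image of the chart -/
  O : Set E
  isOpen : IsOpen O
  mem_target : ∀ z ∈ O, (e z).1 ∈ ψ.target
  plot_τ : ∀ z ∈ O, Plot 𝓘(ℝ, F) τ (ψ.symm (e z).1)
  tgt_τ : ∀ z ∈ O, ∀ᶠ x in 𝓝 (ψ.symm (e z).1), tgt (τ x) = x
  smoothNear_Θ : ∀ z ∈ O,
    SmoothNear (𝓘(ℝ, F).prod 𝓘(ℝ, K)) 𝓘(ℝ, E) Θ (src (τ (ψ.symm (e z).1)), (e z).2)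
  smoothNear_κ : ∀ z ∈ O,
    SmoothNear 𝓘(ℝ, E) 𝓘(ℝ, K) κ (Θ (src (τ (ψ.symm (e z).1)), (e z).2))
  apply_Θ : ∀ z ∈ O, L.t (Θ (src (τ (ψ.symm (e z).1)), (e z).2)) = src (τ (ψ.symm (e z).1)) ∧
    κ (Θ (src (τ (ψ.symm (e z).1)), (e z).2)) = (e z).2
  Θ_apply : ∀ z ∈ O, ∀ᶠ g in 𝓝 (Θ (src (τ (ψ.symm (e z).1)), (e z).2)), Θ (L.t g, κ g) = g

namespace ChartData

variable {K : Type*} [NormedAddCommGroup K] [NormedSpace ℝ K] (c : ChartData hL hA K)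

/-- The point of the unit manifold with given coordinates. -/
def base (z : E) : M := c.ψ.symm (c.e z).1

/-- The small arrow with given coordinates. -/
noncomputable def arrow (z : E) : G := c.Θ (src (c.τ (c.base z)), (c.e z).2)

/-- The parametrization inverse to the chart. -/
noncomputable def param (z : E) : Completion hL hA :=
  mul (c.τ (c.base z)) (ofArrow hL hA (c.arrow z))

variable {c}

theorem tgt_τ_base {z : E} (hz : z ∈ c.O) : tgt (c.τ (c.base z)) = c.base z :=
  (c.tgt_τ z hz).self_of_nhds

theorem src_τ_base {z : E} (hz : z ∈ c.O) :
    src (c.τ (c.base z)) = tgt (ofArrow hL hA (c.arrow z)) := by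
  rw [tgt_ofArrow]; exact (c.apply_Θ z hz).1.symm

theorem tgt_param {z : E} (hz : z ∈ c.O) : tgt (c.param z) = c.base z := by
  rw [param, tgt_mul (src_τ_base hz), tgt_τ_base hz]

theorem smoothNear_base {z : E} (hz : z ∈ c.O) : SmoothNear 𝓘(ℝ, E) 𝓘(ℝ, F) c.base z := by
  have h₁ : SmoothNear 𝓘(ℝ, F) 𝓘(ℝ, F) c.ψ.symm (c.e z).1 :=
    (contMDiffOn_symm_of_mem_maximalAtlas c.mem_maximalAtlas).smoothNear
      (c.ψ.open_target.mem_nhds (c.mem_target z hz))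
  exact h₁.comp_of_eq (((contDiff_fst (𝕜 := ℝ)).comp c.e.contDiff).contMDiff.smoothNear z) rfl

variable [FiniteDimensional ℝ E] [IsManifold 𝓘(ℝ, E) ∞ G] [IsManifold 𝓘(ℝ, F) ∞ M]

theorem plot_param {z : E} (hz : z ∈ c.O) : Plot 𝓘(ℝ, E) c.param z := by
  have h₁ : Plot 𝓘(ℝ, E) (fun z => c.τ (c.base z)) z :=
    (c.plot_τ z hz).comp_of_eq (smoothNear_base hz) rfl
  have h₂ : SmoothNear 𝓘(ℝ, E) 𝓘(ℝ, E) c.arrow z :=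
    (c.smoothNear_Θ z hz).comp_of_eq (h₁.smoothNear_src.prodMk
      (((contDiff_snd (𝕜 := ℝ)).comp c.e.contDiff).contMDiff.smoothNear z)) rfl
  refine h₁.mul (plot_ofArrow h₂) ?_
  filter_upwards [c.isOpen.mem_nhds hz] with y hy using src_τ_base hy

/-- The target recovers the base point; cancelling `τ` and using that `G` embeds in the completion
recovers the small arrow, whose `κ`-coordinate is the remaining component. -/
theorem injOn_param : Set.InjOn c.param c.O := by
  intro z hz z' hz' h
  have h₁ : c.base z = c.base z' := by rw [← tgt_param hz, h, tgt_param hz']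
  have h₂ : (c.e z).1 = (c.e z').1 :=
    c.ψ.symm.injOn (c.mem_target z hz) (c.mem_target z' hz') h₁
  have h₃ : mul (Completion.inv (c.τ (c.base z))) (c.param z) = ofArrow hL hA (c.arrow z) :=
    inv_mul_cancel (src_τ_base hz)
  have h₄ : mul (Completion.inv (c.τ (c.base z'))) (c.param z') = ofArrow hL hA (c.arrow z') :=
    inv_mul_cancel (src_τ_base hz')
  rw [h, h₁, h₄] at h₃
  have h₅ : c.arrow z' = c.arrow z := ofArrow_injective h₃
  have h₆ : (c.e z).2 = (c.e z').2 := by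
    rw [← (c.apply_Θ z hz).2, ← (c.apply_Θ z' hz').2]
    exact congrArg c.κ h₅.symm
  exact c.e.injective (Prod.ext h₂ h₆)

variable (c) in
/-- The chart of the completion, as a partial equivalence. -/
noncomputable def chart : PartialEquiv (Completion hL hA) E :=
  ((injOn_param (c := c)).bijOn_image.toPartialEquiv _ _ _).symm

theorem chart_symm (z : E) : c.chart.symm z = c.param z := rfl

theorem chart_param {z : E} (hz : z ∈ c.O) : c.chart (c.param z) = z := c.chart.right_inv hz

theorem apply_tgt {p : Completion hL hA} (hp : p ∈ c.chart.source) :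
    tgt p ∈ c.ψ.source ∧ c.ψ (tgt p) = (c.e (c.chart p)).1 := by
  have hz : c.chart p ∈ c.O := c.chart.map_source hp
  have h : tgt p = c.base (c.chart p) := by
    rw [← tgt_param hz, ← chart_symm, c.chart.left_inv hp]
  rw [h]
  exact ⟨c.ψ.map_target (c.mem_target _ hz), c.ψ.right_inv (c.mem_target _ hz)⟩

variable {EP HP P : Type*} [NormedAddCommGroup EP] [NormedSpace ℝ EP]
  [TopologicalSpace HP] {I : ModelWithCorners ℝ EP HP} [TopologicalSpace P] [ChartedSpace HP P]

/-- The chart is computed by `a = τ (tgt f)⁻¹ f`, a plot whose value at `p` is an arrow of `G`,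
hence given nearby by a smooth map to `G`; the coordinates are `ψ (tgt f)` and `κ a`. Applied to
`param` of another chart, this gives both open overlaps and smooth transition maps. -/
theorem smoothNear_chart {f : P → Completion hL hA} {p : P} (hf : Plot I f p)
    (hp : f p ∈ c.chart.source) : SmoothNear I 𝓘(ℝ, E) (fun q => c.chart (f q)) p ∧
      ∀ᶠ q in 𝓝 p, f q ∈ c.chart.source := by
  set z := c.chart (f p) with hzdef
  have hz : z ∈ c.O := c.chart.map_source hp
  have hfp : c.param z = f p := c.chart.left_inv hp
  have htp : tgt (f p) = c.base z := by rw [← hfp, tgt_param hz]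
  have h₁ : Plot I (fun q => c.τ (tgt (f q))) p :=
    (c.plot_τ z hz).comp_of_eq hf.smoothNear_tgt htp
  have h₂ : ∀ᶠ q in 𝓝 p, tgt (c.τ (tgt (f q))) = tgt (f q) :=
    hf.smoothNear_tgt.mem_nhds htp (c.tgt_τ z hz)
  have h₃ : Plot I (fun q => mul (Completion.inv (c.τ (tgt (f q)))) (f q)) p := by
    refine h₁.inv.mul hf ?_
    filter_upwards [h₂] with q hq
    rw [src_inv, hq]
  obtain ⟨a, ha, hap, haq⟩ := h₃.exists_lift_arrow (g := c.arrow z) (by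
    rw [htp, ← hfp]; exact inv_mul_cancel (src_τ_base hz))
  have hψ : SmoothNear 𝓘(ℝ, F) 𝓘(ℝ, F) c.ψ (tgt (f p)) :=
    (contMDiffOn_of_mem_maximalAtlas c.mem_maximalAtlas).smoothNear
      (c.ψ.open_source.mem_nhds (apply_tgt hp).1)
  have h₄ : SmoothNear I (𝓘(ℝ, F).prod 𝓘(ℝ, K)) (fun q => (c.ψ (tgt (f q)), c.κ (a q))) p :=
    (hψ.comp_of_eq hf.smoothNear_tgt rfl).prodMk ((c.smoothNear_κ z hz).comp_of_eq ha hap)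
  have h₅ : SmoothNear I 𝓘(ℝ, E) (fun q => c.e.symm (c.ψ (tgt (f q)), c.κ (a q))) p := by
    have : ContMDiff (𝓘(ℝ, F).prod 𝓘(ℝ, K)) 𝓘(ℝ, E) ∞ c.e.symm := by
      rw [← modelWithCornersSelf_prod, chartedSpaceSelf_prod]
      exact c.e.symm.contDiff.contMDiff
    exact (this.smoothNear _).comp_of_eq h₄ rfl
  have h₆ : c.e.symm (c.ψ (tgt (f p)), c.κ (a p)) = z := by
    rw [(apply_tgt hp).2, hap]
    refine (congrArg (fun k => c.e.symm ((c.e z).1, k)) (c.apply_Θ z hz).2).trans ?_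
    simp
  have h₇ : ∀ᶠ q in 𝓝 p, c.e.symm (c.ψ (tgt (f q)), c.κ (a q)) ∈ c.O :=
    h₅.mem_nhds h₆ (c.isOpen.mem_nhds hz)
  have h₈ : ∀ᶠ q in 𝓝 p, tgt (f q) ∈ c.ψ.source :=
    hf.smoothNear_tgt.mem_nhds rfl (c.ψ.open_source.mem_nhds (apply_tgt hp).1)
  have h₉ : ∀ᶠ q in 𝓝 p, c.Θ (L.t (a q), c.κ (a q)) = a q := ha.mem_nhds hap (c.Θ_apply z hz)
  have key : ∀ᶠ q in 𝓝 p, c.e.symm (c.ψ (tgt (f q)), c.κ (a q)) ∈ c.O ∧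
      c.param (c.e.symm (c.ψ (tgt (f q)), c.κ (a q))) = f q := by
    filter_upwards [h₂, haq, h₇, h₈, h₉] with q k₂ k₃ k₇ k₈ k₉
    refine ⟨k₇, ?_⟩
    have hb : c.base (c.e.symm (c.ψ (tgt (f q)), c.κ (a q))) = tgt (f q) := by
      simp [base, c.ψ.left_inv k₈]
    have hs : src (c.τ (tgt (f q))) = L.t (a q) := by
      rw [← tgt_ofArrow (hL := hL) (hA := hA), ← k₃, tgt_mul (by rw [src_inv, k₂]), tgt_inv]
    have har : c.arrow (c.e.symm (c.ψ (tgt (f q)), c.κ (a q))) = a q := by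
      rw [arrow, hb, hs, ContinuousLinearEquiv.apply_symm_apply, k₉]
    rw [param, hb, har, ← k₃]
    exact mul_inv_cancel_left k₂
  constructor
  · refine h₅.congr ?_
    filter_upwards [key] with q hq
    rw [← hq.2, chart_param hq.1, hq.2]
  · filter_upwards [key] with q hq
    rw [← hq.2, ← chart_symm]
    exact c.chart.map_target hq.1

end ChartData

variable [FiniteDimensional ℝ E] [IsManifold 𝓘(ℝ, E) ∞ G] [IsManifold 𝓘(ℝ, F) ∞ M]

/-- Take a section `τ` of the target through `p` and fiber coordinates of `G` at the unit of `src
p`, so that `p` is `τ (tgt p)` times a unit. All requirements hold near the coordinates of `p`, and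
`O` is a neighborhood where they hold together. -/
theorem exists_chartData {K : Type*} [NormedAddCommGroup K] [NormedSpace ℝ K]
    (hK : Manifold.IsSubmersionOfComplement K 𝓘(ℝ, E) 𝓘(ℝ, F) ∞ L.t) (p : Completion hL hA) :
    ∃ c : ChartData hL hA K, p ∈ c.chart.source := by
  obtain ⟨τ, hτ, hτp, hτt⟩ := exists_plot_section p
  set g := L.u (src p)
  have htg : L.t g = src p := L.t_u _
  obtain ⟨κ, Θ, hκ, hΘ, hΘg, hΘκ, hΘκ'⟩ := exists_submersion_coordinates (hK g)
  rw [htg] at hΘ hΘg hΘκ'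
  set ψ := chartAt F (tgt p)
  set e := (hK g).equiv
  have hψm : ψ ∈ IsManifold.maximalAtlas 𝓘(ℝ, F) ∞ M := IsManifold.chart_mem_maximalAtlas _
  have hψp : tgt p ∈ ψ.source := mem_chart_source F _
  set z := e.symm (ψ (tgt p), κ g)
  have hez : e z = (ψ (tgt p), κ g) := e.apply_symm_apply _
  have hb0 : ψ.symm (e z).1 = tgt p := by rw [hez]; exact ψ.left_inv hψp
  have hb : SmoothNear 𝓘(ℝ, E) 𝓘(ℝ, F) (fun y => ψ.symm (e y).1) z := by
    have : SmoothNear 𝓘(ℝ, F) 𝓘(ℝ, F) ψ.symm (ψ (tgt p)) :=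
      (contMDiffOn_symm_of_mem_maximalAtlas hψm).smoothNear
        (ψ.open_target.mem_nhds (ψ.map_source hψp))
    exact this.comp_of_eq (((contDiff_fst (𝕜 := ℝ)).comp e.contDiff).contMDiff.smoothNear z)
      (by simp [hez])
  have hτb : Plot 𝓘(ℝ, E) (fun y => τ (ψ.symm (e y).1)) z := hτ.comp_of_eq hb hb0
  have hin : SmoothNear 𝓘(ℝ, E) (𝓘(ℝ, F).prod 𝓘(ℝ, K))
      (fun y => (src (τ (ψ.symm (e y).1)), (e y).2)) z :=
    hτb.smoothNear_src.prodMk (((contDiff_snd (𝕜 := ℝ)).comp e.contDiff).contMDiff.smoothNear z)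
  have hin0 : (src (τ (ψ.symm (e z).1)), (e z).2) = (src p, κ g) := by rw [hb0, hτp, hez]
  have c₁ : ∀ᶠ y in 𝓝 z, (e y).1 ∈ ψ.target :=
    (((contDiff_fst (𝕜 := ℝ)).comp e.contDiff).contMDiff.smoothNear z
      : SmoothNear 𝓘(ℝ, E) 𝓘(ℝ, F) (fun y => (e y).1) z).mem_nhds (congrArg Prod.fst hez)
      (ψ.open_target.mem_nhds (ψ.map_source hψp))
  have c₂ := hb.mem_nhds hb0 hτ.eventually
  have c₃ := hb.mem_nhds hb0 hτt.eventually_nhds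
  have c₄ := hin.mem_nhds hin0 hΘ.eventually
  have hΘin := hΘ.comp_of_eq hin hin0
  have hΘin0 : Θ (src (τ (ψ.symm (e z).1)), (e z).2) = g := by rw [hin0, hΘg]
  have c₅ := hΘin.mem_nhds hΘin0 hκ.eventually
  have c₆ := hin.mem_nhds hin0 hΘκ'
  have c₇ := hΘin.mem_nhds hΘin0 hΘκ.eventually_nhds
  obtain ⟨O, hO, hOo, hzO⟩ := eventually_nhds_iff.1
    (c₁.and (c₂.and (c₃.and (c₄.and (c₅.and (c₆.and c₇))))))
  let c : ChartData hL hA K := {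
    ψ := ψ
    mem_maximalAtlas := hψm
    e := e
    τ := τ
    κ := κ
    Θ := Θ
    O := O
    isOpen := hOo
    mem_target := fun y hy => (hO y hy).1
    plot_τ := fun y hy => (hO y hy).2.1
    tgt_τ := fun y hy => (hO y hy).2.2.1
    smoothNear_Θ := fun y hy => (hO y hy).2.2.2.1
    smoothNear_κ := fun y hy => (hO y hy).2.2.2.2.1
    apply_Θ := fun y hy => (hO y hy).2.2.2.2.2.1
    Θ_apply := fun y hy => (hO y hy).2.2.2.2.2.2 }
  refine ⟨c, ?_⟩
  have hcp : c.param z = p := by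
    have h₁ : c.base z = tgt p := hb0
    have h₂ : c.arrow z = g := hΘin0
    have h₃ : c.τ (tgt p) = p := hτp
    rw [ChartData.param, h₁, h₂, h₃]
    exact mul_unit p
  rw [← hcp]
  exact c.chart.map_target hzO

end Charts

end Completion

/-! ### The Lie groupoid structure of the completion -/

namespace Completion

variable {E : Type uE} [NormedAddCommGroup E] [NormedSpace ℝ E] [FiniteDimensional ℝ E]
  {F : Type uF} [NormedAddCommGroup F] [NormedSpace ℝ F]
  {G : Type uG} [TopologicalSpace G] [ChartedSpace E G] [IsManifold 𝓘(ℝ, E) ∞ G]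
  {M : Type uM} [TopologicalSpace M] [ChartedSpace F M] [IsManifold 𝓘(ℝ, F) ∞ M]
  {L : LocalLieGroupoid E F G M} {hL : L.StronglyConnected} {hA : L.GloballyAssociative}
  {EP HP P : Type*} [NormedAddCommGroup EP] [NormedSpace ℝ EP]
  [TopologicalSpace HP] {I : ModelWithCorners ℝ EP HP} [TopologicalSpace P] [ChartedSpace HP P]

/-- A choice of chart data at each arrow. -/
noncomputable def chartData (p : Completion hL hA) :
    ChartData hL hA L.isSubmersion_t.complement :=
  (exists_chartData L.isSubmersion_t.isSubmersionOfComplement_complement p).choose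

theorem mem_chart_source (p : Completion hL hA) : p ∈ (chartData p).chart.source :=
  (exists_chartData L.isSubmersion_t.isSubmersionOfComplement_complement p).choose_spec

variable (hL hA) in
/-- The charts of the completion. -/
noncomputable def chartedSpaceCore : ChartedSpaceCore E (Completion hL hA) where
  atlas := Set.range fun p => (chartData p).chart
  chartAt p := (chartData p).chart
  mem_chart_source := mem_chart_source
  chart_mem_atlas p := ⟨p, rfl⟩
  open_source := by
    rintro _ _ ⟨p, rfl⟩ ⟨q, rfl⟩
    rw [isOpen_iff_mem_nhds]
    rintro z ⟨hz, hz'⟩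
    have := (ChartData.smoothNear_chart (ChartData.plot_param hz) hz').2
    filter_upwards [(chartData p).isOpen.mem_nhds hz, this] with y h₁ h₂ using ⟨h₁, h₂⟩
  continuousOn_toFun := by
    rintro _ _ ⟨p, rfl⟩ ⟨q, rfl⟩ z ⟨hz, hz'⟩
    exact (ChartData.smoothNear_chart (ChartData.plot_param hz)
      hz').1.continuousAt.continuousWithinAt

noncomputable instance : TopologicalSpace (Completion hL hA) :=
  (chartedSpaceCore hL hA).toTopologicalSpace

noncomputable instance : ChartedSpace E (Completion hL hA) :=
  (chartedSpaceCore hL hA).toChartedSpace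

instance : IsManifold 𝓘(ℝ, E) ∞ (Completion hL hA) := by
  refine isManifold_of_contDiffOn _ _ _ fun e e' he he' => ?_
  obtain ⟨_, ⟨p, rfl⟩, he⟩ := Set.mem_iUnion₂.1 he
  obtain ⟨_, ⟨q, rfl⟩, he'⟩ := Set.mem_iUnion₂.1 he'
  obtain rfl : e = chartAt E p := he
  obtain rfl : e' = chartAt E q := he'
  rintro z ⟨⟨hz, hz'⟩, -⟩
  exact (ChartData.smoothNear_chart (c := chartData q) (ChartData.plot_param (c := chartData p) hz)
    hz').1.contMDiffAt.contDiffAt.contDiffWithinAt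

/-- Parametrizations are plots, and charts send plots to smooth maps. Smoothness of the operations
thus reduces to operations on families of words. -/
theorem smoothNear_iff_plot {f : P → Completion hL hA} {p : P} :
    SmoothNear I 𝓘(ℝ, E) f p ↔ Plot I f p := by
  constructor
  · intro hf
    have hs := mem_chart_source (f p)
    have hm : SmoothNear 𝓘(ℝ, E) 𝓘(ℝ, E) (chartData (f p)).chart (f p) :=
      (contMDiffOn_chart (n := ∞)).smoothNear ((chartAt E (f p)).open_source.mem_nhds hs)
    have h₁ := (ChartData.plot_param ((chartData (f p)).chart.map_source hs)).comp_of_eq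
      (hm.comp hf) rfl
    refine h₁.congr ?_
    filter_upwards [hf.continuousAt.eventually ((chartAt E (f p)).open_source.mem_nhds hs)] with q hq
    exact (chartData (f p)).chart.left_inv hq
  · intro hf
    have hs := mem_chart_source (f p)
    obtain ⟨h₁, h₂⟩ := ChartData.smoothNear_chart hf hs
    have hm : SmoothNear 𝓘(ℝ, E) 𝓘(ℝ, E) (chartData (f p)).param ((chartData (f p)).chart (f p)) :=
      (contMDiffOn_chart_symm (n := ∞)).smoothNear ((chartAt E (f p)).open_target.mem_nhds
        ((chartAt E (f p)).map_source hs))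
    refine (hm.comp_of_eq h₁ rfl).congr ?_
    filter_upwards [h₂] with q hq using (chartData (f p)).chart.left_inv hq

theorem plot_id (p : Completion hL hA) : Plot 𝓘(ℝ, E) (fun q => q) p :=
  smoothNear_iff_plot.1 (smoothNear_id p)

theorem contMDiff_inv : ContMDiff 𝓘(ℝ, E) 𝓘(ℝ, E) ∞ (inv : Completion hL hA → _) :=
  fun p => (smoothNear_iff_plot.2 (plot_id p).inv).contMDiffAt

theorem contMDiff_ofArrow : ContMDiff 𝓘(ℝ, E) 𝓘(ℝ, E) ∞ (ofArrow hL hA) :=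
  fun g => (smoothNear_iff_plot.2 (plot_ofArrow (smoothNear_id g))).contMDiffAt

theorem contMDiff_unit : ContMDiff 𝓘(ℝ, F) 𝓘(ℝ, E) ∞ (unit hL hA) :=
  contMDiff_ofArrow.comp L.contMDiff_u

theorem contMDiff_tgt : ContMDiff 𝓘(ℝ, E) 𝓘(ℝ, F) ∞ (tgt : Completion hL hA → M) :=
  fun p => (plot_id p).smoothNear_tgt.contMDiffAt

theorem contMDiff_src : ContMDiff 𝓘(ℝ, E) 𝓘(ℝ, F) ∞ (src : Completion hL hA → M) :=
  fun p => (plot_id p).smoothNear_src.contMDiffAt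

/-- The inversion as a homeomorphism. -/
noncomputable def invHomeomorph : Completion hL hA ≃ₜ Completion hL hA where
  toFun := inv
  invFun := inv
  left_inv := inv_inv
  right_inv := inv_inv
  continuous_toFun := contMDiff_inv.continuous
  continuous_invFun := contMDiff_inv.continuous

theorem isSubmersion_tgt :
    Manifold.IsSubmersion 𝓘(ℝ, E) 𝓘(ℝ, F) ∞ (tgt : Completion hL hA → M) := by
  refine ⟨L.isSubmersion_t.complement, inferInstance, inferInstance, fun p => ?_⟩
  have hs := mem_chart_source p
  refine .mk_of_charts (chartData p).e (chartAt E p) (chartData p).ψ hs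
    (ChartData.apply_tgt hs).1 (IsManifold.chart_mem_maximalAtlas _) (chartData p).mem_maximalAtlas
    (fun q hq => (ChartData.apply_tgt hq).1) fun z hz => ?_
  have hz : z ∈ (chartAt E p).target := by simpa using hz
  have hz : z ∈ (chartData p).chart.target := hz
  have h := (ChartData.apply_tgt ((chartData p).chart.map_target hz)).2
  rw [(chartData p).chart.right_inv hz] at h
  have h₁ : (chartData p).ψ (tgt ((chartAt E p).symm z)) = ((chartData p).e z).1 := h
  simpa using h₁

/-- Precomposing the charts at `inv p` with the inversion turns the source into the target, which
these charts put in normal form. -/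
theorem isSubmersion_src :
    Manifold.IsSubmersion 𝓘(ℝ, E) 𝓘(ℝ, F) ∞ (src : Completion hL hA → M) := by
  refine ⟨L.isSubmersion_t.complement, inferInstance, inferInstance, fun p => ?_⟩
  have hs := mem_chart_source (inv p)
  set φ : OpenPartialHomeomorph (Completion hL hA) E :=
    invHomeomorph.transOpenPartialHomeomorph (chartAt E (inv p)) with hφ
  have hφs : φ.source = inv ⁻¹' (chartData (inv p)).chart.source := rfl
  have hφm : φ ∈ IsManifold.maximalAtlas 𝓘(ℝ, E) ∞ (Completion hL hA) := by
    refine φ.mem_maximalAtlas_of_contMDiffOn ?_ ?_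
    · exact (contMDiffOn_chart (n := ∞)).comp contMDiff_inv.contMDiffOn (fun _ h => h)
    · exact contMDiff_inv.comp_contMDiffOn (contMDiffOn_chart_symm (n := ∞))
  refine .mk_of_charts (chartData (inv p)).e φ (chartData (inv p)).ψ hs ?_ hφm
    (chartData (inv p)).mem_maximalAtlas (fun q hq => ?_) fun z hz => ?_
  · rw [← tgt_inv]; exact (ChartData.apply_tgt hs).1
  · have := (ChartData.apply_tgt (c := chartData (inv p)) (p := inv q) hq).1
    rwa [tgt_inv] at this
  · have hz : z ∈ (chartAt E (inv p)).target := by simpa [hφ] using hz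
    have hz : z ∈ (chartData (inv p)).chart.target := hz
    have h := (ChartData.apply_tgt ((chartData (inv p)).chart.map_target hz)).2
    rw [(chartData (inv p)).chart.right_inv hz] at h
    have h₁ : src (φ.symm z) = tgt ((chartData (inv p)).chart.symm z) := src_inv _
    simpa [h₁] using h

/-- Plots need an open parameter space, whereas composable pairs form only a fiber product. The
second factor is therefore replaced by `Θ (src r.1, κ r.2)`, which is composable with `r.1` for all
`r` near `(p, q)` and equals `r.2` when `r` is composable. -/
theorem contMDiffOn_mul : ContMDiffOn (𝓘(ℝ, E).prod 𝓘(ℝ, E)) 𝓘(ℝ, E) ∞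
    (fun p : Completion hL hA × Completion hL hA => mul p.1 p.2) (composablePairs src tgt) := by
  rintro ⟨p, q⟩ hpq
  have hpq : src p = tgt q := hpq
  obtain ⟨K, _, _, hK⟩ := isSubmersion_tgt (hL := hL) (hA := hA)
  obtain ⟨κ, Θ, hκ, hΘ, hΘq, hΘκ, hΘκ'⟩ := exists_submersion_coordinates (hK q)
  have hin : SmoothNear (𝓘(ℝ, E).prod 𝓘(ℝ, E)) (𝓘(ℝ, F).prod 𝓘(ℝ, K))
      (fun r : Completion hL hA × Completion hL hA => (src r.1, κ r.2)) (p, q) :=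
    ((contMDiff_src.smoothNear p).comp_of_eq (smoothNear_fst _) rfl).prodMk
      (hκ.comp_of_eq (smoothNear_snd _) rfl)
  have h₀ : (src p, κ q) = (tgt q, κ q) := by rw [hpq]
  have h₁ : Plot (𝓘(ℝ, E).prod 𝓘(ℝ, E)) (fun r : Completion hL hA × Completion hL hA =>
      Θ (src r.1, κ r.2)) (p, q) := smoothNear_iff_plot.1 (hΘ.comp_of_eq hin h₀)
  have h₂ : Plot (𝓘(ℝ, E).prod 𝓘(ℝ, E)) (fun r : Completion hL hA × Completion hL hA => r.1)
      (p, q) := smoothNear_iff_plot.1 (smoothNear_fst _)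
  have h₃ := smoothNear_iff_plot.2 (h₂.mul h₁ (by
    filter_upwards [hin.mem_nhds h₀ hΘκ'] with r hr using hr.1.symm))
  refine h₃.contMDiffAt.contMDiffWithinAt.congr_of_eventuallyEq_of_mem ?_ hpq
  have h₄ : ∀ᶠ r : Completion hL hA × Completion hL hA in 𝓝 (p, q), Θ (tgt r.2, κ r.2) = r.2 :=
    (continuous_snd.tendsto (p, q)).eventually hΘκ
  filter_upwards [mem_nhdsWithin_of_mem_nhds h₄, self_mem_nhdsWithin] with r hr hr'
  have hr' : src r.1 = tgt r.2 := hr'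
  rw [hr', hr]

/-- If an ultrafilter on the fiber has limits `p` and `q`, their targets agree because `M` is
Hausdorff. The constant `r⁻¹ r = unit x` then tends to `p⁻¹ q`, and in a T1 space this forces `p⁻¹
q` to be that unit. -/
theorem t2_source_fiber [T2Space M] (x : M) :
    T2Space ((src : Completion hL hA → M) ⁻¹' {x}) := by
  have : T1Space (Completion hL hA) := ChartedSpace.t1Space E _
  refine t2_iff_ultrafilter.2 fun {p q} f hp hq => ?_
  have hp' : Filter.Tendsto (fun r : (src : Completion hL hA → M) ⁻¹' {x} => (r : Completion hL hA))
      f (𝓝 p) := (continuous_subtype_val.tendsto p).mono_left hp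
  have hq' : Filter.Tendsto (fun r : (src : Completion hL hA → M) ⁻¹' {x} => (r : Completion hL hA))
      f (𝓝 q) := (continuous_subtype_val.tendsto q).mono_left hq
  have ht : tgt (p : Completion hL hA) = tgt (q : Completion hL hA) :=
    tendsto_nhds_unique ((contMDiff_tgt.continuous.tendsto _).comp hp')
      ((contMDiff_tgt.continuous.tendsto _).comp hq')
  have hc : src (inv (p : Completion hL hA)) = tgt (q : Completion hL hA) := by rw [src_inv, ht]
  have h₁ : Filter.Tendsto (fun r : (src : Completion hL hA → M) ⁻¹' {x} =>
      mul (inv (r : Completion hL hA)) r) f (𝓝 (mul (inv p) q)) := by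
    refine (contMDiffOn_mul (inv (p : Completion hL hA), (q : Completion hL hA))
      hc).continuousWithinAt.tendsto.comp (tendsto_nhdsWithin_iff.2
        ⟨((contMDiff_inv.continuous.tendsto _).comp hp').prodMk_nhds hq', .of_forall fun r => ?_⟩)
    exact src_inv _
  have h₂ : ∀ r : (src : Completion hL hA → M) ⁻¹' {x},
      mul (inv (r : Completion hL hA)) r = unit hL hA x := fun r => by
    rw [inv_mul, show src (r : Completion hL hA) = x from r.2]
  simp only [h₂] at h₁
  have h₃ := tendsto_const_nhds_iff.1 h₁
  have h₄ := mul_inv_cancel_left ht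
  have h₅ := mul_unit (p : Completion hL hA)
  rw [show src (p : Completion hL hA) = x from p.2] at h₅
  rw [← h₃] at h₄
  exact Subtype.ext (h₅.symm.trans h₄)

theorem t2_target_fiber [T2Space M] (x : M) :
    T2Space ((tgt : Completion hL hA → M) ⁻¹' {x}) := by
  have := t2_source_fiber (hL := hL) (hA := hA) x
  refine T2Space.of_injective_continuous
    (f := fun p : (tgt : Completion hL hA → M) ⁻¹' {x} =>
      (⟨inv p, (src_inv _).trans p.2⟩ : (src : Completion hL hA → M) ⁻¹' {x})) ?_ ?_
  · intro p q h
    have : inv (p : Completion hL hA) = inv (q : Completion hL hA) := congrArg Subtype.val h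
    exact Subtype.ext (by rw [← inv_inv (p : Completion hL hA), this, inv_inv])
  · exact (contMDiff_inv.continuous.comp continuous_subtype_val).subtype_mk _

/-- A Lindelöf set lies in countably many chart domains. Products with one more factor are a
countable union, over the charts already found, of continuous images of subsets of `G × E`, which is
hereditarily Lindelöf. -/
theorem exists_countable_cover_products [SecondCountableTopology G] (n : ℕ) :
    ∃ C : Set (Completion hL hA), C.Countable ∧
      products hL hA n ⊆ ⋃ c ∈ C, (chartAt E c).source := by
  have cover : ∀ S : Set (Completion hL hA), IsLindelof S → ∃ C : Set (Completion hL hA),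
      C.Countable ∧ S ⊆ ⋃ c ∈ C, (chartAt E c).source := fun S hS => by
    obtain ⟨C, hC, -, h⟩ := hS.elim_nhds_subcover (fun c => (chartAt E c).source)
      fun c _ => chart_source_mem_nhds E c
    exact ⟨C, hC, h⟩
  induction n with
  | zero =>
    refine cover _ ?_
    rw [products, ← Set.image_univ]
    exact isLindelof_univ.image contMDiff_ofArrow.continuous
  | succ n ih =>
    obtain ⟨C, hC, h⟩ := ih
    let S : Completion hL hA → Set (G × E) := fun c =>
      {z | z.2 ∈ (chartData c).O ∧ L.s z.1 = tgt ((chartData c).param z.2)}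
    have hS : ∀ c, IsLindelof ((fun z : G × E =>
        mul (ofArrow hL hA z.1) ((chartData c).param z.2)) '' S c) := fun c => by
      refine (HereditarilyLindelofSpace.isLindelof (S c)).image_of_continuousOn fun z hz => ?_
      have hc : src (ofArrow hL hA z.1) = tgt ((chartData c).param z.2) := by
        rw [src_ofArrow, hz.2]
      have hp : ContinuousAt (chartData c).param z.2 :=
        (smoothNear_iff_plot.2 (ChartData.plot_param hz.1)).continuousAt
      refine (contMDiffOn_mul (ofArrow hL hA z.1, (chartData c).param z.2)
        hc).continuousWithinAt.tendsto.comp (f := fun z : G × E =>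
          (ofArrow hL hA z.1, (chartData c).param z.2)) (tendsto_nhdsWithin_iff.2 ⟨?_, ?_⟩)
      · refine Filter.Tendsto.mono_left ?_ nhdsWithin_le_nhds
        exact ((contMDiff_ofArrow.continuous.tendsto _).comp (continuous_fst.tendsto z)).prodMk_nhds
          (hp.tendsto.comp (continuous_snd.tendsto z))
      · filter_upwards [self_mem_nhdsWithin] with y hy
        exact (src_ofArrow _).trans hy.2
    obtain ⟨D, hD, hD'⟩ := cover _ (hC.isLindelof_biUnion fun c _ => hS c)
    refine ⟨D, hD, fun p hp => hD' ?_⟩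
    obtain ⟨g, q, hq, hgq, rfl⟩ := hp
    obtain ⟨c, hc, hqc⟩ := Set.mem_iUnion₂.1 (h hq)
    have hq' : (chartData c).param ((chartData c).chart q) = q := (chartData c).chart.left_inv hqc
    refine Set.mem_iUnion₂.2 ⟨c, hc, (g, (chartData c).chart q),
      ⟨(chartData c).chart.map_source hqc, ?_⟩, ?_⟩
    · rw [hq']; exact hgq
    · simp only [hq']

instance [SecondCountableTopology G] : SecondCountableTopology (Completion hL hA) := by
  choose C hC hC' using exists_countable_cover_products (hL := hL) (hA := hA)
  refine ChartedSpace.secondCountable_of_countable_cover E (s := ⋃ n, C n) ?_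
    (Set.countable_iUnion hC)
  refine Set.eq_univ_of_forall fun p => ?_
  obtain ⟨n, hn⟩ := exists_mem_products p
  obtain ⟨c, hc, hpc⟩ := Set.mem_iUnion₂.1 (hC' n hn)
  exact Set.mem_iUnion₂.2 ⟨c, Set.mem_iUnion.2 ⟨n, hc⟩, hpc⟩

variable (hL hA) in
/-- The completion as a Lie groupoid. -/
noncomputable def lieGroupoid [T2Space M] : LieGroupoid E F (Completion hL hA) M where
  s := src
  t := tgt
  u := unit hL hA
  mul := mul
  inv := inv
  isSubmersion_s := isSubmersion_src
  isSubmersion_t := isSubmersion_tgt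
  t2_source_fiber := t2_source_fiber
  t2_target_fiber := t2_target_fiber
  contMDiff_u := contMDiff_unit
  contMDiffOn_mul := contMDiffOn_mul
  contMDiff_inv := contMDiff_inv
  s_u := src_unit
  t_u := tgt_unit
  s_mul _ _ := src_mul
  t_mul _ _ := tgt_mul
  mul_assoc _ _ _ := mul_assoc
  mul_unit := mul_unit
  unit_mul := unit_mul
  s_inv := src_inv
  t_inv := tgt_inv
  inv_mul := inv_mul
  mul_inv := mul_inv

theorem exists_local_inverse_ofArrow (g : G) : ∃ c : Completion hL hA → G,
    SmoothNear 𝓘(ℝ, E) 𝓘(ℝ, E) c (ofArrow hL hA g) ∧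
      ∀ᶠ q in 𝓝 (ofArrow hL hA g), q = ofArrow hL hA (c q) := by
  obtain ⟨c, hc, -, h⟩ := (plot_id (ofArrow hL hA g)).exists_lift_arrow rfl
  exact ⟨c, hc, h⟩

variable (hL hA) in
/-- The image of a local Lie groupoid in its completion. -/
noncomputable def range : TopologicalSpace.Opens (Completion hL hA) where
  carrier := Set.range (ofArrow hL hA)
  is_open' := by
    rw [isOpen_iff_mem_nhds]
    rintro _ ⟨g, rfl⟩
    obtain ⟨c, -, h⟩ := exists_local_inverse_ofArrow (hL := hL) (hA := hA) g
    filter_upwards [h] with q hq using ⟨c q, hq.symm⟩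

variable (hL hA) in
/-- A local Lie groupoid is diffeomorphic to its image in the completion. -/
noncomputable def rangeDiffeomorph : Diffeomorph 𝓘(ℝ, E) 𝓘(ℝ, E) G (range hL hA) ∞ where
  toEquiv := Equiv.ofInjective (ofArrow hL hA) ofArrow_injective
  contMDiff_toFun := (ContMDiff.subtypeVal_comp_iff (range hL hA) _).1 contMDiff_ofArrow
  contMDiff_invFun := by
    rintro ⟨_, g, rfl⟩
    obtain ⟨c, hc, h⟩ := exists_local_inverse_ofArrow (hL := hL) (hA := hA) g
    have h₁ : ContMDiffAt 𝓘(ℝ, E) 𝓘(ℝ, E) ∞ (fun q : range hL hA => c q)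
        ⟨ofArrow hL hA g, g, rfl⟩ := contMDiffAt_subtype_iff.2 hc.contMDiffAt
    refine h₁.congr_of_eventuallyEq ?_
    filter_upwards [(continuous_subtype_val.tendsto
      (⟨ofArrow hL hA g, g, rfl⟩ : range hL hA)).eventually h] with q hq
    refine (Equiv.symm_apply_eq _).2 (Subtype.ext ?_)
    exact hq

theorem isRestrictionOf [T2Space M] :
    L.IsRestrictionOf (lieGroupoid hL hA) (range hL hA) (rangeDiffeomorph hL hA) where
  unit_mem x := ⟨L.u x, rfl⟩
  map_s := src_ofArrow
  map_t := tgt_ofArrow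
  map_u _ := rfl
  mul_mem g h hgh := ⟨L.mul g h, (ofArrow_mul hgh).symm⟩
  map_mul _ _ hgh := (ofArrow_mul hgh).symm
  inv_mem g hg := ⟨L.inv g, ofArrow_inv hg⟩
  map_inv _ hg := ofArrow_inv hg

end Completion

/-! ### Globalizable local Lie groupoids are globally associative -/

section Main

variable {E : Type uE} [NormedAddCommGroup E] [NormedSpace ℝ E]
  {F : Type uF} [NormedAddCommGroup F] [NormedSpace ℝ F]
  {G : Type uG} [TopologicalSpace G] [ChartedSpace E G]
  {M : Type uM} [TopologicalSpace M] [ChartedSpace F M]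
  {L : LocalLieGroupoid E F G M}

/-- The product of a composable word in a Lie groupoid. -/
def wordProd {H : Type uG} [TopologicalSpace H] [ChartedSpace E H] (𝒢 : LieGroupoid E F H M) :
    List H → M → H
  | [], x => 𝒢.u x
  | g :: w, x => 𝒢.mul g (wordProd 𝒢 w x)

theorem IsRestrictionOf.t_wordProd {H : Type uG} [TopologicalSpace H] [ChartedSpace E H]
    {𝒢 : LieGroupoid E F H M} {Ω : TopologicalSpace.Opens H}
    {Φ : Diffeomorph 𝓘(ℝ, E) 𝓘(ℝ, E) G Ω ∞} (h : L.IsRestrictionOf 𝒢 Ω Φ) {w : List G} {y x : M}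
    (hw : L.IsPath y w x) : 𝒢.t (wordProd 𝒢 (w.map fun g => (Φ g : H)) x) = y := by
  induction w generalizing y with
  | nil => simpa [wordProd, 𝒢.t_u] using hw.symm
  | cons g w ih =>
    obtain ⟨rfl, hw⟩ := hw
    simp only [wordProd, List.map_cons]
    rw [𝒢.t_mul _ _ (by rw [h.map_s, ih hw]), h.map_t]

theorem IsRestrictionOf.wordProd_append {H : Type uG} [TopologicalSpace H] [ChartedSpace E H]
    {𝒢 : LieGroupoid E F H M} {Ω : TopologicalSpace.Opens H}
    {Φ : Diffeomorph 𝓘(ℝ, E) 𝓘(ℝ, E) G Ω ∞} (h : L.IsRestrictionOf 𝒢 Ω Φ) {a b : List G} {z y x : M}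
    (ha : L.IsPath z a y) (hb : L.IsPath y b x) :
    wordProd 𝒢 ((a ++ b).map fun g => (Φ g : H)) x =
      𝒢.mul (wordProd 𝒢 (a.map fun g => (Φ g : H)) y) (wordProd 𝒢 (b.map fun g => (Φ g : H)) x) ∧
    𝒢.s (wordProd 𝒢 (a.map fun g => (Φ g : H)) y) = y := by
  induction a generalizing z with
  | nil =>
    refine ⟨?_, by simp [wordProd, 𝒢.s_u]⟩
    have := 𝒢.unit_mul (wordProd 𝒢 (b.map fun g => (Φ g : H)) x)
    rw [h.t_wordProd hb] at this
    exact this.symm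
  | cons g a ih =>
    obtain ⟨rfl, ha⟩ := ha
    obtain ⟨ih₁, ih₂⟩ := ih ha
    have hc : 𝒢.s (Φ g : H) = 𝒢.t (wordProd 𝒢 (a.map fun g => (Φ g : H)) y) := by
      rw [h.map_s, h.t_wordProd ha]
    simp only [wordProd, List.map_cons, List.cons_append]
    rw [ih₁, 𝒢.mul_assoc _ _ _ hc (by rw [ih₂, h.t_wordProd hb]), 𝒢.s_mul _ _ hc]
    exact ⟨rfl, ih₂⟩

/-- The right-hand side depends on the word but not on the bracketing, by associativity in `𝒢`. -/
theorem IsRestrictionOf.map_evaluatesTo {H : Type uG} [TopologicalSpace H] [ChartedSpace E H]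
    {𝒢 : LieGroupoid E F H M} {Ω : TopologicalSpace.Opens H}
    {Φ : Diffeomorph 𝓘(ℝ, E) 𝓘(ℝ, E) G Ω ∞} (h : L.IsRestrictionOf 𝒢 Ω Φ) {w : List G} {g : G}
    (hg : L.EvaluatesTo w g) : (Φ g : H) = wordProd 𝒢 (w.map fun g => (Φ g : H)) (L.s g) := by
  induction hg with
  | single g =>
    have := 𝒢.mul_unit (Φ g : H)
    rw [h.map_s] at this
    exact this.symm
  | @mul w₁ w₂ a b h₁ h₂ hab ih₁ ih₂ =>
    have hc := mem_composable hab
    rw [h.map_mul _ _ hab, L.s_mul _ _ hab, (h.wordProd_append h₁.isPath (hc ▸ h₂.isPath)).1,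
      ← ih₁, ← ih₂]

theorem Globalizable.globallyAssociative (h : L.Globalizable) : L.GloballyAssociative := by
  obtain ⟨H, _, _, _, _, 𝒢, Ω, Φ, h⟩ := h
  intro n _ w _ _ _ g g' hg hg'
  have hs : L.s g = L.s g' := (hg.isPath.unique hg.ne_nil hg'.isPath).2
  refine Φ.injective (Subtype.ext ?_)
  change (Φ g : H) = Φ g'
  rw [h.map_evaluatesTo hg, h.map_evaluatesTo hg', hs]

end Main

end LocalLieGroupoid

theorem mainTheorem2
    {E : Type uE} [NormedAddCommGroup E] [NormedSpace ℝ E] [FiniteDimensional ℝ E]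
    {F : Type uF} [NormedAddCommGroup F] [NormedSpace ℝ F] [FiniteDimensional ℝ F]
    {G : Type uG} [TopologicalSpace G] [SecondCountableTopology G]
    [ChartedSpace E G] [IsManifold 𝓘(ℝ, E) ∞ G]
    {M : Type uM} [TopologicalSpace M] [T2Space M] [SecondCountableTopology M]
    [ChartedSpace F M] [IsManifold 𝓘(ℝ, F) ∞ M]
    (L : LocalLieGroupoid E F G M) (hL : L.StronglyConnected) :
    L.Globalizable ↔ L.GloballyAssociative :=
  ⟨fun h => h.globallyAssociative, fun hA =>
    ⟨LocalLieGroupoid.Completion hL hA, inferInstance, inferInstance, inferInstance, inferInstance,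
      LocalLieGroupoid.Completion.lieGroupoid hL hA, LocalLieGroupoid.Completion.range hL hA,
      LocalLieGroupoid.Completion.rangeDiffeomorph hL hA,
      LocalLieGroupoid.Completion.isRestrictionOf⟩⟩
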